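/- Let $\mathcal X$ be a finite alphabet. A semimeasure is a function $\rho:\mathcal X^*\to[0,1]$ with $\rho(\epsilon)\le 1$ and $\sum_{a\in\mathcal X}\rho(xa)\le\rho(x)$ for all $x$; it is a measure if both are equalities. A function $f:\mathcal X^*\to[0,\infty)$ is enumerable (co-enumerable) if the set of pairs $(x,q)$, $q\ge 0$ rational, with $f(x)>q$ (with $f(x)<q$) is recursively enumerable; an index of an enumerable $f$ is the number of a program that enumerates the first of these sets. A measure $\mu$ is computable if it is enumerable and co-enumerable and $\{x:\mu(x)=0\}$ is decidable. Let $U$ be a universal prefix machine with binary programs and side information in $\mathcal X^*$ (for every prefix machine $T$ there is a constant $c_T$ such that whenever $T(p,x)=n$, some $q$ with $\ell(q)\le\ell(p)+c_T$ has $U(q,x)=n$). Put $K(n|x)=\min\{\ell(p):U(p,x)=n\}$ and $K(n)=K(n|\epsilon)$ for natural numbers $n$; for an enumerable function $f$ let $K(f|x)$ be the minimum of $K(i|x)$ over all indices $i$ of $f$, and $K(f)=K(f|\epsilon)$. Let $$M(x)=\sum_{\nu}2^{-K(\nu)}\,\nu(x),$$ where $\nu$ runs over all enumerable semimeasures, and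 $M(y|x)=M(xy)/M(x)$. For every computable measure $\mu$ fix a version of the conditional probability: $\mu(y|x)=\mu(xy)/\mu(x)$ if $\mu(x)\ne 0$, while if $\mu(x)=0$, then $\mu(\cdot|x)$ is a measure that can be computed from $x$ and an index of $\mu$ (for example the uniform measure). Theorem. There is a constant $c$ (depending only on $\mathcal X$, $U$ and the choice of versions) such that for every computable measure $\mu$ and all $x,y\in\mathcal X^*$ $$\log_2\frac{\mu(y|x)}{M(y|x)}\;\le\;K(\mu|x)+K(\ell(x))+c ,$$ where $\ell(x)$ is the length of $x$. -/

import Mathlib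

namespace AlgoPrediction

/-! ## Semimeasures on finite strings -/

section Semimeasures

variable {X : Type*} [Fintype X]

/-- A semimeasure `ρ : X* → [0,1]`. -/
structure IsSemimeasure (ρ : List X → ℝ) : Prop where
  nonneg : ∀ x, 0 ≤ ρ x
  le_one : ∀ x, ρ x ≤ 1
  nil_le : ρ [] ≤ 1
  sum_le : ∀ x, ∑ a : X, ρ (x ++ [a]) ≤ ρ x

/-- A (probability) measure `ρ : X* → [0,1]`. -/
structure IsMeasure (ρ : List X → ℝ) : Prop where
  nonneg : ∀ x, 0 ≤ ρ x
  le_one : ∀ x, ρ x ≤ 1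
  nil_eq : ρ [] = 1
  sum_eq : ∀ x, ∑ a : X, ρ (x ++ [a]) = ρ x

end Semimeasures

/-! ## Enumerable functions and computable measures

All functions below are nonnegative, so that it is enough to compare them with the nonnegative
rationals, written `k / (n + 1)` with natural numbers `k`, `n`. -/

section Enumerable

variable {X : Type*} [Primcodable X]

/-- `f` is enumerable (lower semicomputable): `{(x, q) ∣ f x > q}` is recursively enumerable. -/
def Enumerable (f : List X → ℝ) : Prop :=
  REPred fun t : List X × ℕ × ℕ => (t.2.1 : ℝ) / ((t.2.2 : ℝ) + 1) < f t.1

/-- `f` is co-enumerable (upper semicomputable): `{(x, q) ∣ f x < q}` is recursively enumerable. -/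
def CoEnumerable (f : List X → ℝ) : Prop :=
  REPred fun t : List X × ℕ × ℕ => f t.1 < (t.2.1 : ℝ) / ((t.2.2 : ℝ) + 1)

/-- A computable measure: enumerable, co-enumerable, and with a decidable set of zeros. -/
structure IsComputableMeasure [Fintype X] (μ : List X → ℝ) : Prop where
  isMeasure : IsMeasure μ
  enumerable : Enumerable μ
  coEnumerable : CoEnumerable μ
  decidable_zero : ComputablePred fun x : List X => μ x = 0

/-- The number `i` is an index of the enumerable function `f`: the `i`-th program halts exactly
on the (codes of the) pairs `(x, q)` with `f x > q`. -/
def IsIndex (i : ℕ) (f : List X → ℝ) : Prop :=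
  ∀ (x : List X) (k n : ℕ),
    ((Denumerable.ofNat Nat.Partrec.Code i).eval (Encodable.encode (x, k, n))).Dom ↔
      (k : ℝ) / ((n : ℝ) + 1) < f x

end Enumerable

/-! ## Prefix complexity and the universal mixture -/

section Complexity

variable {X : Type*} [Primcodable X]

/-- A prefix machine with binary programs `p` and side information `x : X*`: a partial computable
function whose domain is, for each `x`, a prefix-free set of programs. Outputs are natural numbers
(every constructive object is identified with its code). -/
structure IsPrefixMachine (T : List Bool × List X →. ℕ) : Prop where
  partrec : Partrec T
  prefixFree : ∀ (x : List X) (p q : List Bool),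
    (T (p, x)).Dom → (T (q, x)).Dom → p <+: q → p = q

/-- A universal (additively optimal) prefix machine. -/
structure IsUniversal (U : List Bool × List X →. ℕ) : Prop where
  isPrefixMachine : IsPrefixMachine U
  optimal : ∀ T : List Bool × List X →. ℕ, IsPrefixMachine T →
    ∃ c : ℕ, ∀ (p : List Bool) (x : List X) (n : ℕ), n ∈ T (p, x) →
      ∃ q : List Bool, q.length ≤ p.length + c ∧ n ∈ U (q, x)

/-- `K(n | x)`, the length of a shortest program that outputs `n` on input `x`. -/
noncomputable def condK (U : List Bool × List X →. ℕ) (n : ℕ) (x : List X) : ℕ :=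
  sInf {m | ∃ p : List Bool, p.length = m ∧ n ∈ U (p, x)}

/-- `K(n) = K(n | ε)`. -/
noncomputable def plainK (U : List Bool × List X →. ℕ) (n : ℕ) : ℕ :=
  condK U n []

/-- `K(f | x)` for an enumerable function `f`: the least `K(i | x)` over all indices `i` of `f`. -/
noncomputable def condKFun (U : List Bool × List X →. ℕ) (f : List X → ℝ) (x : List X) : ℕ :=
  sInf {m | ∃ i : ℕ, IsIndex i f ∧ condK U i x = m}

/-- The universal mixture `M(x) = ∑_ν 2^{-K(ν)} ν(x)`, over the set of all enumerable
semimeasures `ν`, where `K(ν) = K(ν | ε)`. -/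
noncomputable def mixture [Fintype X] (U : List Bool × List X →. ℕ) (x : List X) : ℝ :=
  ∑' ν : {ν : List X → ℝ // IsSemimeasure ν ∧ Enumerable ν},
    ((1 : ℝ) / 2) ^ condKFun U ν.1 [] * ν.1 x

end Complexity

/-! ## Conditional probabilities -/

section Versions

variable {X : Type*} [Fintype X] [Primcodable X]

/-- A choice `V`, for each computable measure `μ`, of one version `V μ x y` of the conditional
probability `μ(y | x)`. It is a probability measure in `y`, it is `μ(xy) / μ(x)` where this makes
sense, and on the strings `x` with `μ(x) = 0`, where it is arbitrary otherwise, it is computable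
from `x` and `μ` (as it is a measure, it suffices to enumerate it, given an index of `μ`). -/
structure IsConditionalVersion (V : (List X → ℝ) → List X → List X → ℝ) : Prop where
  isMeasure : ∀ μ, IsComputableMeasure μ → ∀ x, IsMeasure (V μ x)
  eq_div : ∀ μ, IsComputableMeasure μ → ∀ x, μ x ≠ 0 → ∀ y, V μ x y = μ (x ++ y) / μ x
  effective : ∃ R : ℕ × List X × List X × ℕ × ℕ → Prop, REPred R ∧
    ∀ μ, IsComputableMeasure μ → ∀ i, IsIndex i μ → ∀ x, μ x = 0 → ∀ (y : List X) (k n : ℕ),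
      (R (i, x, y, k, n) ↔ (k : ℝ) / ((n : ℝ) + 1) < V μ x y)

open Classical in
/-- The version that is the uniform measure after strings of probability zero. -/
noncomputable def uniformVersion (μ : List X → ℝ) (x y : List X) : ℝ :=
  if μ x = 0 then ((1 : ℝ) / (Fintype.card X : ℝ)) ^ y.length else μ (x ++ y) / μ x

end Versions

/-! ## The uniform version is a legitimate choice -/

section Uniform

variable {X : Type*} [Fintype X]

theorem IsMeasure.append_le {μ : List X → ℝ} (h : IsMeasure μ) (x y : List X) :
    μ (x ++ y) ≤ μ x := by
  induction y using List.reverseRecOn with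
  | nil => simp
  | append_singleton y a ih =>
    refine le_trans ?_ ih
    rw [← h.sum_eq (x ++ y), ← List.append_assoc]
    exact Finset.single_le_sum (f := fun a => μ (x ++ y ++ [a])) (fun b _ => h.nonneg _)
      (Finset.mem_univ a)

theorem IsMeasure.card_pos {μ : List X → ℝ} (h : IsMeasure μ) : 0 < Fintype.card X := by
  rw [Fintype.card_pos_iff]
  by_contra hX
  rw [not_nonempty_iff] at hX
  have := h.sum_eq []
  rw [h.nil_eq] at this
  simp at this

theorem isConditionalVersion_uniformVersion [Primcodable X] :
    IsConditionalVersion (uniformVersion (X := X)) where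
  isMeasure μ hμ x := by
    have hm := hμ.isMeasure
    have hc : (0 : ℝ) < Fintype.card X := by exact_mod_cast hm.card_pos
    have hc1 : (1 : ℝ) ≤ Fintype.card X := by exact_mod_cast hm.card_pos
    by_cases hx : μ x = 0
    · have hV : uniformVersion μ x = fun y => ((1 : ℝ) / (Fintype.card X : ℝ)) ^ y.length := by
        funext y; simp [uniformVersion, hx]
      rw [hV]
      refine ⟨fun y => by positivity, fun y => pow_le_one₀ (by positivity) ?_, by simp, ?_⟩
      · rw [div_le_one hc]; exact hc1
      · intro y
        simp only [List.length_append, List.length_singleton, Finset.sum_const, Finset.card_univ,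
          nsmul_eq_mul, pow_succ]
        field_simp
    · have hV : uniformVersion μ x = fun y => μ (x ++ y) / μ x := by
        funext y; simp [uniformVersion, hx]
      rw [hV]
      have hpos : 0 < μ x := lt_of_le_of_ne (hm.nonneg x) (Ne.symm hx)
      refine ⟨fun y => div_nonneg (hm.nonneg _) hpos.le, fun y => ?_, ?_, fun y => ?_⟩
      · rw [div_le_one hpos]; exact hm.append_le x y
      · simp [hx]
      · rw [← Finset.sum_div, ← hm.sum_eq (x ++ y)]
        simp
  eq_div μ _ x hx y := by simp [uniformVersion, hx]
  effective := by
    refine ⟨fun t => t.2.2.2.1 * Fintype.card X ^ t.2.2.1.length < t.2.2.2.2 + 1, ?_, ?_⟩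
    · have hpow : Primrec₂ (fun a b : ℕ => a ^ b) :=
        (Primrec.nat_rec' (f := fun p : ℕ × ℕ => p.2) (g := fun _ : ℕ × ℕ => 1)
          (h := fun (p : ℕ × ℕ) (q : ℕ × ℕ) => q.2 * p.1) Primrec.snd (Primrec.const 1)
          (Primrec.nat_mul.comp (Primrec.snd.comp Primrec.snd)
            (Primrec.fst.comp Primrec.fst))).of_eq fun p => by
              obtain ⟨a, b⟩ := p
              dsimp only
              induction b with
              | zero => simp
              | succ b ih => rw [pow_succ, ← ih]
      have h2 : Primrec fun t : ℕ × List X × List X × ℕ × ℕ => t.2.2 :=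
        Primrec.snd.comp Primrec.snd
      refine (PrimrecPred.computablePred ?_).to_re
      refine Primrec.nat_lt.comp (Primrec.nat_mul.comp
        (Primrec.fst.comp (Primrec.snd.comp h2))
        (hpow.comp (Primrec.const _) (Primrec.list_length.comp (Primrec.fst.comp h2))))
        (Primrec.succ.comp (Primrec.snd.comp (Primrec.snd.comp h2)))
    · intro μ hμ i _ x hx y k n
      have hc : (0 : ℝ) < Fintype.card X := by exact_mod_cast hμ.isMeasure.card_pos
      have hV : uniformVersion μ x y = ((1 : ℝ) / (Fintype.card X : ℝ)) ^ y.length := by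
        simp [uniformVersion, hx]
      rw [hV, one_div_pow, div_lt_div_iff₀ (by positivity) (by positivity), one_mul]
      exact_mod_cast Iff.rfl

end Uniform

end AlgoPrediction

open AlgoPrediction

/-! Put `n = ℓ(x)`. The idea is to build, for each `n`, an enumerable semimeasure `ν_n` that behaves
like `M` up to length `n` and then continues with a mixture of all candidate conditional
probabilities given the prefix already read: `ν_n(xy) = ρ(x) κ(x, y)` with `κ(x, y) = ∑_p 2^{-ℓ(p)}
σ(i, x)(y)`, where `i = U(p, x)` and `p` runs over the programs that halt on `x`. The programs for
an index of `μ` receive `x` as side information inside `κ`, so the index costs only `K(μ|x)`.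
Outside `κ` only the splicing level has to be described, which costs `K(n)`. Hence `M(xy) ≥
2^{-K(n)-c} ν_n(xy) ≥ 2^{-K(n)-c-K(μ|x)} M(x) μ(y|x)`.

Three points need work. The mixture `M` is not visibly enumerable, as its weights minimise over all
indices of a function; it is replaced by an enumerable semimeasure `ρ ≥ M` that sums over programs
(`IsUniversal.mixture_le_mix`). An arbitrary index need not describe a semimeasure, so enumerations
are trimmed to semimeasures, without changing those that already are (`exists_trimmed`). Finally,
`μ(xy)/μ(x)` must be enumerated from an index that gives `μ` only from below; `μ(x)` is approximated
from above as `1` minus the other strings of its length (`exists_enumeration_conditional`).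

The splice and its domination by `M` are in `IsUniversal.exists_mul_mixture_le`. -/

namespace AlgoPrediction

open Filter Topology

/-! ### Recursive enumerability through primitive recursive approximation from below. -/

section Computability

variable {α β : Type*} [Primcodable α] [Primcodable β]

/-- A partial computable function is the increasing union of primitive recursive stages. -/
theorem exists_primrec_stages {f : α →. ℕ} (hf : Partrec f) :
    ∃ st : α → ℕ → Option ℕ, Primrec₂ st ∧
      (∀ a s t n, s ≤ t → n ∈ st a s → n ∈ st a t) ∧ ∀ a n, n ∈ f a ↔ ∃ s, n ∈ st a s := by
  obtain ⟨c, hc⟩ := Nat.Partrec.Code.exists_code.1 hf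
  refine ⟨fun a s => Nat.Partrec.Code.evaln s c (Encodable.encode a), ?_, ?_, ?_⟩
  · exact Nat.Partrec.Code.primrec_evaln.comp
      ((Primrec.snd.pair (Primrec.const c)).pair (Primrec.encode.comp Primrec.fst))
  · intro a s t n hst h
    exact Nat.Partrec.Code.evaln_mono hst h
  · intro a n
    rw [← Nat.Partrec.Code.evaln_complete, hc]
    simp

theorem exists_primrec_stages_of_rePred {p : α → Prop} (hp : REPred p) :
    ∃ Q : α → ℕ → Bool, Primrec₂ Q ∧ (∀ a s t, s ≤ t → Q a s = true → Q a t = true) ∧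
      ∀ a, p a ↔ ∃ s, Q a s = true := by
  have hf : Partrec fun a => (Part.assert (p a) fun _ => Part.some ()).map fun _ => (0 : ℕ) :=
    Partrec.map hp (Computable.const 0).to₂
  obtain ⟨st, hst, hmono, hmem⟩ := exists_primrec_stages hf
  refine ⟨fun a s => (st a s).isSome, Primrec.option_isSome.comp hst, ?_, ?_⟩
  · intro a s t hle h
    obtain ⟨n, hn⟩ := Option.isSome_iff_exists.1 h
    exact Option.isSome_iff_exists.2 ⟨n, hmono a s t n hle hn⟩
  · intro a
    constructor
    · intro h
      obtain ⟨s, hs⟩ := (hmem a 0).1 (by simp [Part.mem_assert_iff, h])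
      exact ⟨s, Option.isSome_iff_exists.2 ⟨0, hs⟩⟩
    · rintro ⟨s, hs⟩
      obtain ⟨n, hn⟩ := Option.isSome_iff_exists.1 hs
      have := (hmem a n).2 ⟨s, hn⟩
      simp only [Part.mem_map_iff, Part.mem_assert_iff] at this
      obtain ⟨_, ⟨h, _⟩, _⟩ := this
      exact h

theorem rePred_exists {p : α → ℕ → Prop} (hp : PrimrecRel p) : REPred fun a => ∃ s, p a s := by
  classical
  have h : Primrec₂ fun a s => decide (p a s) := hp.decide
  have h1 : Partrec fun a => Nat.rfind fun s => Part.some (decide (p a s)) :=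
    Partrec.rfind h.to_comp.partrec₂
  refine h1.dom_re.of_eq fun a => ?_
  constructor
  · intro h
    exact ⟨_, by simpa using Nat.rfind_spec (Part.get_mem h)⟩
  · rintro ⟨s, hs⟩
    refine (Nat.rfind_dom (p := fun s => Part.some (decide (p a s)))).2
      ⟨s, by simpa using hs, fun _ => trivial⟩

theorem REPred.comp {p : β → Prop} (hp : REPred p) {f : α → β} (hf : Computable f) :
    REPred fun a => p (f a) :=
  Partrec.comp hp hf

theorem primrec_nat_pow : Primrec₂ fun a b : ℕ => a ^ b :=
  (Primrec.nat_rec' (f := fun p : ℕ × ℕ => p.2) (g := fun _ : ℕ × ℕ => 1)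
    (h := fun (p : ℕ × ℕ) (q : ℕ × ℕ) => q.2 * p.1) Primrec.snd (Primrec.const 1)
    (Primrec.nat_mul.comp (Primrec.snd.comp Primrec.snd)
      (Primrec.fst.comp Primrec.fst))).of_eq fun p => by
        obtain ⟨a, b⟩ := p
        dsimp only
        induction b with
        | zero => simp
        | succ b ih => rw [pow_succ, ← ih]

theorem primrec_sum_range {f : α → ℕ} {g : α → ℕ → ℕ} (hf : Primrec f) (hg : Primrec₂ g) :
    Primrec fun a => ∑ m ∈ Finset.range (f a), g a m :=
  (Primrec.nat_rec' (f := f) (g := fun _ => 0) (h := fun a q => q.2 + g a q.1) hf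
    (Primrec.const 0) (Primrec.nat_add.comp (Primrec.snd.comp Primrec.snd)
      (hg.comp Primrec.fst (Primrec.fst.comp Primrec.snd)))).of_eq fun a => by
        induction f a with
        | zero => simp
        | succ b ih => rw [Finset.sum_range_succ, ← ih]

theorem primrec_list_sum_map {f : α → List β} {g : α → β → ℕ} (hf : Primrec f) (hg : Primrec₂ g) :
    Primrec fun a => ((f a).map (g a)).sum :=
  (Primrec.list_foldr (f := f) (g := fun _ => 0) (h := fun a q => g a q.1 + q.2) hf
    (Primrec.const 0) (Primrec.nat_add.comp
      (hg.comp Primrec.fst (Primrec.fst.comp Primrec.snd))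
      (Primrec.snd.comp Primrec.snd)).to₂).of_eq fun a => by
        induction f a with
        | nil => simp
        | cons b l ih => simp only [List.foldr_cons, List.map_cons, List.sum_cons, ← ih]

theorem primrec_dropLast : Primrec (List.dropLast : List α → List α) :=
  (Primrec.list_reverse.comp (Primrec.list_tail.comp Primrec.list_reverse)).of_eq fun l => by
    simp

theorem primrec_list_count [BEq α] [LawfulBEq α] :
    Primrec₂ fun (a : α) (l : List α) => l.count a := by
  classical
  refine (primrec_list_sum_map (f := fun p : α × List α => p.2)
    (g := fun p b => if b = p.1 then 1 else 0) Primrec.snd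
    (Primrec.ite (Primrec.eq.comp Primrec.snd (Primrec.fst.comp Primrec.fst))
      (Primrec.const 1) (Primrec.const 0)).to₂).of_eq fun p => ?_
  obtain ⟨a, l⟩ := p
  dsimp only
  induction l with
  | nil => simp
  | cons b l ih =>
    simp only [List.map_cons, List.sum_cons, ih, List.count_cons, beq_iff_eq]
    ring

theorem primrec_replicate : Primrec₂ fun (n : ℕ) (a : α) => List.replicate n a :=
  (Primrec.list_map (f := fun p : ℕ × α => List.range p.1) (g := fun p _ => p.2)
    (Primrec.list_range.comp Primrec.fst) (Primrec.snd.comp Primrec.fst).to₂).of_eq fun p => by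
      simp

/-- A real function is lower computable if it is the limit of an increasing sequence of
nonnegative rationals `φ a s / B ^ s` with `φ` primitive recursive. -/
def LowerComputable (f : α → ℝ) : Prop :=
  ∃ (B : ℕ) (φ : α → ℕ → ℕ), 0 < B ∧ Primrec₂ φ ∧ ∀ a,
    Monotone (fun s => (φ a s : ℝ) / (B : ℝ) ^ s) ∧
      Tendsto (fun s => (φ a s : ℝ) / (B : ℝ) ^ s) atTop (𝓝 (f a))

theorem LowerComputable.comp {f : β → ℝ} (hf : LowerComputable f) {g : α → β} (hg : Primrec g) :
    LowerComputable fun a => f (g a) := by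
  obtain ⟨B, φ, hB, hφ, h⟩ := hf
  exact ⟨B, fun a s => φ (g a) s, hB, hφ.comp (hg.comp Primrec.fst) Primrec.snd, fun a => h (g a)⟩

/-- The denominators multiply, which is why the base `B` is not fixed to be `2`. -/
theorem LowerComputable.mul {f g : α → ℝ} (hf : LowerComputable f) (hg : LowerComputable g) :
    LowerComputable fun a => f a * g a := by
  obtain ⟨B, φ, hB, hφ, h⟩ := hf
  obtain ⟨C, ψ, hC, hψ, h'⟩ := hg
  have e : ∀ a s, ((φ a s * ψ a s : ℕ) : ℝ) / ((B * C : ℕ) : ℝ) ^ s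
      = (φ a s : ℝ) / (B : ℝ) ^ s * ((ψ a s : ℝ) / (C : ℝ) ^ s) := by
    intro a s
    push_cast
    rw [mul_pow, div_mul_div_comm]
  refine ⟨B * C, fun a s => φ a s * ψ a s, Nat.mul_pos hB hC, Primrec.nat_mul.comp hφ hψ,
    fun a => ⟨?_, ?_⟩⟩
  · intro s t hst
    simp only [e]
    exact mul_le_mul ((h a).1 hst) ((h' a).1 hst) (by positivity) (by positivity)
  · simp only [e]
    exact (h a).2.mul (h' a).2

theorem LowerComputable.ite {p : α → Prop} [DecidablePred p] (hp : PrimrecPred p) {f g : α → ℝ}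
    (hf : LowerComputable f) (hg : LowerComputable g) :
    LowerComputable fun a => if p a then f a else g a := by
  obtain ⟨B, φ, hB, hφ, h⟩ := hf
  obtain ⟨C, ψ, hC, hψ, h'⟩ := hg
  have hB' : (B : ℝ) ≠ 0 := by positivity
  have hC' : (C : ℝ) ≠ 0 := by positivity
  have e : ∀ a s, ((if p a then φ a s * C ^ s else ψ a s * B ^ s : ℕ) : ℝ) / ((B * C : ℕ) : ℝ) ^ s
      = if p a then (φ a s : ℝ) / (B : ℝ) ^ s else ((ψ a s : ℝ) / (C : ℝ) ^ s) := by
    intro a s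
    split_ifs <;> push_cast <;> rw [mul_pow] <;> field_simp
  refine ⟨B * C, fun a s => if p a then φ a s * C ^ s else ψ a s * B ^ s, Nat.mul_pos hB hC,
    Primrec.ite (hp.comp Primrec.fst)
      (Primrec.nat_mul.comp hφ (primrec_nat_pow.comp (Primrec.const C) Primrec.snd))
      (Primrec.nat_mul.comp hψ (primrec_nat_pow.comp (Primrec.const B) Primrec.snd)), fun a => ?_⟩
  simp only [e]
  split_ifs
  · exact h a
  · exact h' a

/-- The approximations increase to the limit, so a strict lower bound on the limit already holds at
some stage; at one stage it is an inequality between natural numbers. -/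
theorem LowerComputable.rePred {f : α → ℝ} (hf : LowerComputable f) :
    REPred fun t : α × ℕ × ℕ => (t.2.1 : ℝ) / ((t.2.2 : ℝ) + 1) < f t.1 := by
  obtain ⟨B, φ, hB, hφ, h⟩ := hf
  refine (rePred_exists (p := fun (t : α × ℕ × ℕ) s => t.2.1 * B ^ s < φ t.1 s * (t.2.2 + 1))
    ?_).of_eq ?_
  · have h2 : Primrec fun q : (α × ℕ × ℕ) × ℕ => q.1.2 := Primrec.snd.comp Primrec.fst
    exact Primrec.nat_lt.comp (Primrec.nat_mul.comp (Primrec.fst.comp h2)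
      (primrec_nat_pow.comp (Primrec.const B) Primrec.snd))
      (Primrec.nat_mul.comp (hφ.comp (Primrec.fst.comp Primrec.fst) Primrec.snd)
        (Primrec.succ.comp (Primrec.snd.comp h2)))
  · rintro ⟨a, k, n⟩
    have key : ∀ s, k * B ^ s < φ a s * (n + 1) ↔
        (k : ℝ) / ((n : ℝ) + 1) < (φ a s : ℝ) / (B : ℝ) ^ s := by
      intro s
      rw [div_lt_div_iff₀ (by positivity) (by positivity)]
      exact_mod_cast Iff.rfl
    simp only [key]
    constructor
    · rintro ⟨s, hs⟩
      exact hs.trans_le ((h a).1.ge_of_tendsto (h a).2 s)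
    · intro hlt
      exact ((h a).2.eventually_const_lt hlt).exists

end Computability

/-! ### Nonnegative reals and the fractions below them. -/

section Fractions

theorem exists_nat_frac_btwn {r u : ℝ} (hr : 0 ≤ r) (h : r < u) :
    ∃ k n : ℕ, r < (k : ℝ) / ((n : ℝ) + 1) ∧ (k : ℝ) / ((n : ℝ) + 1) < u := by
  obtain ⟨q, h1, h2⟩ := exists_rat_btwn h
  have hq : 0 < q := by exact_mod_cast hr.trans_lt h1
  have e : ((q.num.toNat : ℕ) : ℝ) / (((q.den - 1 : ℕ) : ℝ) + 1) = q := by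
    have hd : ((q.den - 1 : ℕ) : ℝ) + 1 = q.den := by
      exact_mod_cast Nat.sub_add_cancel q.den_pos
    have hn : ((q.num.toNat : ℕ) : ℝ) = q.num := by
      exact_mod_cast Int.toNat_of_nonneg (Rat.num_pos.2 hq).le
    rw [hd, hn, Rat.cast_def]
  exact ⟨q.num.toNat, q.den - 1, e ▸ h1, e ▸ h2⟩

/-- A nonnegative real is determined by the nonnegative fractions below it. -/
theorem le_of_forall_frac_lt {u v : ℝ} (hv : 0 ≤ v)
    (h : ∀ k n : ℕ, (k : ℝ) / ((n : ℝ) + 1) < u → (k : ℝ) / ((n : ℝ) + 1) ≤ v) : u ≤ v := by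
  by_contra! hlt
  obtain ⟨k, n, h1, h2⟩ := exists_nat_frac_btwn hv hlt
  exact (h k n h2).not_gt h1

end Fractions

/-! ### The Kraft inequality for prefix-free sets. -/

section Kraft

/-- A prefix-free code without the empty word is uniquely decodable, so Kraft–McMillan applies. The
code `{[]}` is not uniquely decodable and is treated apart. -/
theorem sum_length_le_one_of_prefixFree (S : Finset (List Bool))
    (hS : ∀ p ∈ S, ∀ q ∈ S, p <+: q → p = q) :
    ∑ p ∈ S, ((1 : ℝ) / 2) ^ p.length ≤ 1 := by
  by_cases h : [] ∈ S
  · have : S = {[]} := by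
      refine Finset.eq_singleton_iff_unique_mem.2 ⟨h, fun q hq => (hS [] h q hq ?_).symm⟩
      exact List.nil_prefix
    simp [this]
  · have hu : InformationTheory.UniquelyDecodable (S : Set (List Bool)) := by
      intro L₁
      induction L₁ with
      | nil =>
        rintro (_ | ⟨q, L₂⟩) - h2 he
        · rfl
        · have : q = [] := by
            simp only [List.flatten_nil, List.flatten_cons] at he
            exact (List.append_eq_nil_iff.1 he.symm).1
          exact absurd (h2 q (by simp)) (by simpa [this] using h)
      | cons p L₁ ih =>
        rintro (_ | ⟨q, L₂⟩) h1 h2 he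
        · have : p = [] := by
            simp only [List.flatten_nil, List.flatten_cons] at he
            exact (List.append_eq_nil_iff.1 he).1
          exact absurd (h1 p (by simp)) (by simpa [this] using h)
        · simp only [List.flatten_cons] at he
          have hp : p ∈ S := by simpa using h1 p (by simp)
          have hq : q ∈ S := by simpa using h2 q (by simp)
          have hpq : p = q := by
            rcases List.prefix_or_prefix_of_prefix (l₃ := p ++ L₁.flatten)
              (List.prefix_append _ _) (he ▸ List.prefix_append q L₂.flatten) with h' | h'
            · exact hS p hp q hq h'
            · exact (hS q hq p hp h').symm
          subst hpq
          rw [ih L₂ (fun w hw => h1 w (by simp [hw])) (fun w hw => h2 w (by simp [hw]))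
            (List.append_cancel_left he)]
    simpa using InformationTheory.kraft_mcmillan_inequality hu

end Kraft

/-! ### Attained complexities and computable families of indices. -/

section Complexity

variable {X : Type*} [Primcodable X] {U : List Bool × List X →. ℕ}

/-- The machine that outputs the length of the unary program `1 ... 1 0`. -/
theorem exists_prefixMachine_surjective :
    ∃ T : List Bool × List X →. ℕ, IsPrefixMachine T ∧ ∀ n x, ∃ p, n ∈ T (p, x) := by
  classical
  let g : List Bool × List X → Option ℕ := fun t =>
    if t.1 = List.replicate (t.1.length - 1) true ++ [false] then some (t.1.length - 1) else none
  have hlen : Primrec fun t : List Bool × List X => t.1.length - 1 :=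
    Primrec.pred.comp (Primrec.list_length.comp Primrec.fst)
  have hg : Primrec g := Primrec.ite
    (Primrec.eq.comp Primrec.fst (Primrec.list_concat.comp
      (primrec_replicate.comp hlen (Primrec.const true)) (Primrec.const false)))
    (Primrec.option_some.comp hlen) (Primrec.const none)
  have hdom : ∀ p x, ((g (p, x) : Part ℕ)).Dom → p = List.replicate (p.length - 1) true ++ [false] := by
    intro p x h
    by_contra hp
    have : g (p, x) = none := if_neg hp
    rw [this] at h
    exact h
  refine ⟨fun t => (g t : Part ℕ), ⟨hg.to_comp.ofOption, ?_⟩, ?_⟩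
  · intro x p q hp hq hpq
    have h1 := hdom p x hp
    have h2 := hdom q x hq
    have hl := hpq.length_le
    rcases hl.lt_or_eq with hlt | heq
    -- A proper prefix would end in `false` at a place where the longer codeword still has `true`.
    · exfalso
      have hp0 : 0 < p.length := by rw [h1]; simp
      have e1 : p[p.length - 1]? = some false := by
        conv_lhs => rw [h1]
        simp
      have e2 : q[p.length - 1]? = some true := by
        rw [h2, List.getElem?_append_left (by simp; omega), List.getElem?_replicate]
        simp; omega
      obtain ⟨r, rfl⟩ := hpq
      rw [List.getElem?_append_left (by omega), e1] at e2
      simp at e2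
    · exact hpq.eq_of_length heq
  · intro n x
    refine ⟨List.replicate n true ++ [false], ?_⟩
    have : g (List.replicate n true ++ [false], x) = some n := by
      simp [g]
    simp [this]

/-- This makes the infimum defining `condK` a minimum instead of the default value `0` of `sInf ∅`.
-/
theorem IsUniversal.exists_program (hU : IsUniversal U) (n : ℕ) (x : List X) :
    ∃ p, n ∈ U (p, x) := by
  obtain ⟨T, hT, hs⟩ := exists_prefixMachine_surjective (X := X)
  obtain ⟨c, hc⟩ := hU.optimal T hT
  obtain ⟨p, hp⟩ := hs n x
  obtain ⟨q, -, hq⟩ := hc p x n hp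
  exact ⟨q, hq⟩

theorem IsUniversal.exists_length_eq_condK (hU : IsUniversal U) (n : ℕ) (x : List X) :
    ∃ p : List Bool, p.length = condK U n x ∧ n ∈ U (p, x) := by
  obtain ⟨p, hp⟩ := hU.exists_program n x
  exact Nat.sInf_mem (s := {m | ∃ p : List Bool, p.length = m ∧ n ∈ U (p, x)}) ⟨_, p, rfl, hp⟩

theorem condK_le {X : Type*} {U : List Bool × List X →. ℕ} {p : List Bool} {x : List X} {n : ℕ} (h : n ∈ U (p, x)) :
    condK U n x ≤ p.length :=
  Nat.sInf_le ⟨p, rfl, h⟩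

theorem condKFun_le {i : ℕ} {f : List X → ℝ} (h : IsIndex i f) (x : List X) :
    condKFun U f x ≤ condK U i x :=
  Nat.sInf_le ⟨i, h, rfl⟩

/-- The s-m-n theorem: one program enumerates the whole family, and fixing its first argument is a
computable operation on codes. -/
theorem exists_isIndex_family {ν : ℕ → List X → ℝ}
    (hν : REPred fun t : ℕ × List X × ℕ × ℕ => (t.2.2.1 : ℝ) / ((t.2.2.2 : ℝ) + 1) < ν t.1 t.2.1) :
    ∃ j : ℕ → ℕ, Computable j ∧ ∀ n, IsIndex (j n) (ν n) := by
  obtain ⟨c, hc⟩ := Nat.Partrec.Code.exists_code.1 hν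
  refine ⟨fun n => Encodable.encode (Nat.Partrec.Code.curry c n), ?_, ?_⟩
  · exact (Primrec.encode.comp (Nat.Partrec.Code.primrec₂_curry.comp (Primrec.const c)
      Primrec.id)).to_comp
  · intro n x k m
    have e : Nat.pair n (Encodable.encode (x, k, m)) = Encodable.encode (n, x, k, m) := by
      simp
    rw [Denumerable.ofNat_encode, Nat.Partrec.Code.eval_curry, e, hc]
    simp only [Encodable.encodek]
    simp [Part.assert]

theorem Enumerable.exists_isIndex {f : List X → ℝ} (hf : Enumerable f) : ∃ i, IsIndex i f := by
  obtain ⟨j, -, hj⟩ := exists_isIndex_family (ν := fun _ => f)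
    (REPred.comp hf Primrec.snd.to_comp)
  exact ⟨j 0, hj 0⟩

theorem exists_isIndex_condK_eq {f : List X → ℝ} (hf : Enumerable f) (x : List X) :
    ∃ i, IsIndex i f ∧ condK U i x = condKFun U f x := by
  obtain ⟨i, hi⟩ := hf.exists_isIndex
  exact Nat.sInf_mem (s := {m | ∃ i : ℕ, IsIndex i f ∧ condK U i x = m}) ⟨_, i, hi, rfl⟩

end Complexity

/-! ### Basic properties of semimeasures. -/

theorem IsSemimeasure.of_nil_le {X : Type*} [Fintype X] {ρ : List X → ℝ} (h0 : ∀ x, 0 ≤ ρ x)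
    (h1 : ρ [] ≤ 1) (h2 : ∀ x, ∑ a : X, ρ (x ++ [a]) ≤ ρ x) : IsSemimeasure ρ := by
  refine ⟨h0, fun x => ?_, h1, h2⟩
  induction x using List.reverseRecOn with
  | nil => exact h1
  | append_singleton y a ih =>
    exact ((Finset.single_le_sum (f := fun a => ρ (y ++ [a])) (fun b _ => h0 _)
      (Finset.mem_univ a)).trans (h2 y)).trans ih

theorem IsMeasure.isSemimeasure {X : Type*} [Fintype X] {ρ : List X → ℝ} (h : IsMeasure ρ) :
    IsSemimeasure ρ :=
  ⟨h.nonneg, h.le_one, h.nil_eq.le, fun x => (h.sum_eq x).le⟩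

theorem IsSemimeasure.of_tendsto {X : Type*} [Fintype X] {f : ℕ → List X → ℝ} {g : List X → ℝ}
    (hf : ∀ s, IsSemimeasure (f s)) (h : ∀ y, Tendsto (fun s => f s y) atTop (𝓝 (g y))) :
    IsSemimeasure g where
  nonneg y := ge_of_tendsto' (h y) fun s => (hf s).nonneg y
  le_one y := le_of_tendsto' (h y) fun s => (hf s).le_one y
  nil_le := le_of_tendsto' (h []) fun s => (hf s).nil_le
  sum_le y := le_of_tendsto_of_tendsto' (tendsto_finsetSum _ fun a _ => h (y ++ [a])) (h y)
    fun s => (hf s).sum_le y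

/-! ### Forcing an enumeration to describe a semimeasure

A list of strings is read as a finite multiset of coins of equal value lying on the nodes of the
tree of strings. At each step the value of a coin is halved, the coins are doubled, and coins are
added at one node when an enumerated claim asks for it and the parent node can pay for it. -/

section Trim

variable {X : Type*} [DecidableEq X]

/-- The parent of a string in the tree of strings; the empty string has none. -/
def parentNode (z : List X) : Option (List X) := if z = [] then none else some z.dropLast

/-- The number of coins on the children of a node. -/
def childCoins (o : Option (List X)) (L : List (List X)) : ℕ := (L.map parentNode).count o

/-- The number of coins available to the children of a node. -/
def capacity (s : ℕ) (o : Option (List X)) (L : List (List X)) : ℕ :=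
  -- The missing parent of the root acts as a node of total value `1`, so the bound at the root and
  -- the bounds at the other nodes become one invariant.
  o.elim (2 ^ s) fun u => L.count u

/-- Raise the number of coins at `c.1` to (nearly) the fraction `c.2.1 / (c.2.2 + 1)` of `2 ^ s`. -/
def raiseCoins (b : Bool) (s : ℕ) (c : List X × ℕ × ℕ) (L : List (List X)) : List (List X) :=
  -- All or nothing: either the parent can pay for the whole raise or nothing changes. The
  -- subtraction is truncated, so a node that already has enough coins receives none.
  if b = true ∧ childCoins (parentNode c.1) L + (c.2.1 * 2 ^ s / (c.2.2 + 1) - L.count c.1) ≤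
      capacity s (parentNode c.1) L then
    L ++ List.replicate (c.2.1 * 2 ^ s / (c.2.2 + 1) - L.count c.1) c.1
  else L

/-- The coins after `s` steps, with claims accepted by the test `Q`. -/
def coins [Primcodable X] (Q : List X × ℕ × ℕ → ℕ → Bool) : ℕ → List (List X)
  | 0 => []
  -- Since only the first component of `s.unpair` names the claim, every claim is reconsidered at
  -- infinitely many steps.
  | s + 1 => ((Encodable.decode s.unpair.1 : Option (List X × ℕ × ℕ)).elim (coins Q s ++ coins Q s)
      fun c => raiseCoins (Q c s) (s + 1) c (coins Q s ++ coins Q s))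

/-- New coins at a node count as child coins only for its parent, where the test leaves room; every
capacity can only grow. -/
theorem childCoins_le_capacity_raiseCoins {b : Bool} {s : ℕ} {c : List X × ℕ × ℕ}
    {L : List (List X)} (h : ∀ o, childCoins o L ≤ capacity s o L) (o : Option (List X)) :
    childCoins o (raiseCoins b s c L) ≤ capacity s o (raiseCoins b s c L) := by
  unfold raiseCoins
  split_ifs with hc
  · have hcap : capacity s o L ≤ capacity s o (L ++ List.replicate
        (c.2.1 * 2 ^ s / (c.2.2 + 1) - L.count c.1) c.1) := by
      cases o <;> simp [capacity]
    refine le_trans ?_ hcap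
    simp only [childCoins, List.map_append, List.map_replicate, List.count_append,
      List.count_replicate, beq_iff_eq]
    split_ifs with ho
    · subst ho
      exact hc.2
    · exact h o
  · exact h o

theorem childCoins_le_capacity_double {s : ℕ} {L : List (List X)}
    (h : ∀ o, childCoins o L ≤ capacity s o L) (o : Option (List X)) :
    childCoins o (L ++ L) ≤ capacity (s + 1) o (L ++ L) := by
  have := h o
  cases o <;> simp [childCoins, capacity, pow_succ] at this ⊢ <;> omega

theorem count_raiseCoins_ge (b : Bool) (s : ℕ) (c : List X × ℕ × ℕ) (L : List (List X))
    (y : List X) : L.count y ≤ (raiseCoins b s c L).count y := by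
  unfold raiseCoins
  split_ifs <;> simp

theorem childCoins_some [Fintype X] (u : List X) (L : List (List X)) :
    ∑ a : X, L.count (u ++ [a]) = childCoins (some u) L := by
  induction L with
  | nil => simp [childCoins]
  | cons z L ih =>
    simp only [childCoins, List.map_cons, List.count_cons] at ih ⊢
    rw [Finset.sum_add_distrib, ih]
    congr 1
    rcases List.eq_nil_or_concat z with rfl | ⟨w, b, rfl⟩
    · simp [parentNode]
    · by_cases hw : w = u
      · subst hw
        simp [parentNode]
      · simp [parentNode, hw]

theorem childCoins_none (L : List (List X)) : L.count [] = childCoins none L := by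
  induction L with
  | nil => simp [childCoins]
  | cons z L ih =>
    simp only [childCoins, List.map_cons, List.count_cons] at ih ⊢
    rw [ih]
    congr 1
    by_cases hz : z = [] <;> simp [parentNode, hz]

variable [Primcodable X]

theorem coins_succ_of_none {Q : List X × ℕ × ℕ → ℕ → Bool} {s : ℕ}
    (h : (Encodable.decode s.unpair.1 : Option (List X × ℕ × ℕ)) = none) :
    coins Q (s + 1) = coins Q s ++ coins Q s := by
  simp only [coins, h, Option.elim]

theorem coins_succ_of_some {Q : List X × ℕ × ℕ → ℕ → Bool} {s : ℕ} {c : List X × ℕ × ℕ}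
    (h : (Encodable.decode s.unpair.1 : Option (List X × ℕ × ℕ)) = some c) :
    coins Q (s + 1) = raiseCoins (Q c s) (s + 1) c (coins Q s ++ coins Q s) := by
  simp only [coins, h, Option.elim]

theorem childCoins_le_capacity_coins (Q : List X × ℕ × ℕ → ℕ → Bool) (s : ℕ)
    (o : Option (List X)) : childCoins o (coins Q s) ≤ capacity s o (coins Q s) := by
  induction s generalizing o with
  | zero => simp [coins, childCoins]
  | succ s ih =>
    cases h : (Encodable.decode s.unpair.1 : Option (List X × ℕ × ℕ)) with
    | none =>
      rw [coins_succ_of_none h]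
      exact childCoins_le_capacity_double ih o
    | some c =>
      rw [coins_succ_of_some h]
      exact childCoins_le_capacity_raiseCoins (childCoins_le_capacity_double ih) o

/-- The value of the coins on the node `y` after `s` steps. -/
noncomputable def coinValue (Q : List X × ℕ × ℕ → ℕ → Bool) (s : ℕ) (y : List X) : ℝ :=
  ((coins Q s).count y : ℝ) / 2 ^ s

theorem coinValue_mono (Q : List X × ℕ × ℕ → ℕ → Bool) (y : List X) :
    Monotone fun s => coinValue Q s y := by
  refine monotone_nat_of_le_succ fun s => ?_
  have h : 2 * (coins Q s).count y ≤ (coins Q (s + 1)).count y := by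
    have e : 2 * (coins Q s).count y = (coins Q s ++ coins Q s).count y := by
      rw [List.count_append]; ring
    cases h : (Encodable.decode s.unpair.1 : Option (List X × ℕ × ℕ)) with
    | none => rw [coins_succ_of_none h, e]
    | some c =>
      rw [coins_succ_of_some h, e]
      exact count_raiseCoins_ge _ _ _ _ _
  have h' : (2 : ℝ) * (coins Q s).count y ≤ (coins Q (s + 1)).count y := by exact_mod_cast h
  unfold coinValue
  rw [div_le_div_iff₀ (by positivity) (by positivity), pow_succ]
  nlinarith [show (0 : ℝ) < 2 ^ s by positivity]

theorem isSemimeasure_coinValue [Fintype X] (Q : List X × ℕ × ℕ → ℕ → Bool) (s : ℕ) :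
    IsSemimeasure (coinValue Q s) := by
  refine IsSemimeasure.of_nil_le (fun x => by unfold coinValue; positivity) ?_ fun x => ?_
  · have := childCoins_le_capacity_coins Q s none
    rw [← childCoins_none] at this
    unfold coinValue
    rw [div_le_one (by positivity)]
    exact_mod_cast this
  · have := childCoins_le_capacity_coins Q s (some x)
    rw [← childCoins_some] at this
    unfold coinValue
    rw [← Finset.sum_div]
    gcongr
    exact_mod_cast this

/-- The value of the coins on a node in the limit. -/
noncomputable def trimmed (Q : List X × ℕ × ℕ → ℕ → Bool) (y : List X) : ℝ :=
  ⨆ s, coinValue Q s y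

theorem tendsto_coinValue [Fintype X] (Q : List X × ℕ × ℕ → ℕ → Bool) (y : List X) :
    Tendsto (fun s => coinValue Q s y) atTop (𝓝 (trimmed Q y)) :=
  tendsto_atTop_ciSup (coinValue_mono Q y)
    ⟨1, by rintro _ ⟨s, rfl⟩; exact (isSemimeasure_coinValue Q s).le_one y⟩

theorem isSemimeasure_trimmed [Fintype X] (Q : List X × ℕ × ℕ → ℕ → Bool) : IsSemimeasure (trimmed Q) :=
  IsSemimeasure.of_tendsto (isSemimeasure_coinValue Q) (tendsto_coinValue Q)

/-- Doubling the coins while halving their value preserves the value of a node, and a raise stops at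
the rounded-down value of a true claim. -/
theorem coinValue_le {Q : List X × ℕ × ℕ → ℕ → Bool} {f : List X → ℝ} (h0 : ∀ y, 0 ≤ f y)
    (hQ : ∀ y k n s, Q (y, k, n) s = true → (k : ℝ) / ((n : ℝ) + 1) < f y) (s : ℕ) (y : List X) :
    coinValue Q s y ≤ f y := by
  induction s with
  | zero => simpa [coinValue, coins] using h0 y
  | succ s ih =>
    have e : ((coins Q s ++ coins Q s).count y : ℝ) ≤ f y * 2 ^ (s + 1) := by
      unfold coinValue at ih
      rw [div_le_iff₀ (by positivity)] at ih
      rw [List.count_append, pow_succ]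
      push_cast
      linarith
    unfold coinValue
    rw [div_le_iff₀ (by positivity)]
    cases h : (Encodable.decode s.unpair.1 : Option (List X × ℕ × ℕ)) with
    | none => rwa [coins_succ_of_none h]
    | some c =>
      rw [coins_succ_of_some h]
      unfold raiseCoins
      split_ifs with hc
      · obtain ⟨z, k, n⟩ := c
        rw [List.count_append, List.count_replicate]
        split_ifs with hz
        · obtain rfl : z = y := by simpa using hz
          rcases le_total (k * 2 ^ (s + 1) / (n + 1)) ((coins Q s ++ coins Q s).count z) with hT | hT
          · simpa only [Nat.sub_eq_zero_of_le hT, Nat.add_zero] using e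
          · simp only
            rw [Nat.add_sub_cancel' hT]
            have h1 : ((k * 2 ^ (s + 1) / (n + 1) : ℕ) : ℝ) ≤
                ((k * 2 ^ (s + 1) : ℕ) : ℝ) / ((n + 1 : ℕ) : ℝ) := Nat.cast_div_le
            push_cast at h1
            refine h1.trans ?_
            rw [mul_div_right_comm]
            have := hQ z k n s hc.1
            gcongr
        · simpa using e
      · exact e

/-- If the claims are the fractions below a semimeasure, nothing is lost. -/
theorem le_trimmed [Fintype X] {Q : List X × ℕ × ℕ → ℕ → Bool} {f : List X → ℝ} (hf : IsSemimeasure f)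
    (hmono : ∀ c s t, s ≤ t → Q c s = true → Q c t = true)
    (hQ : ∀ y k n, (∃ s, Q (y, k, n) s = true) ↔ (k : ℝ) / ((n : ℝ) + 1) < f y) (y : List X) :
    f y ≤ trimmed Q y := by
  have hle : ∀ s y, coinValue Q s y ≤ f y :=
    coinValue_le hf.nonneg fun y k n s h => (hQ y k n).1 ⟨s, h⟩
  have hsup : ∀ s y, coinValue Q s y ≤ trimmed Q y := fun s y =>
    (coinValue_mono Q y).ge_of_tendsto (tendsto_coinValue Q y) s
  -- it suffices that there is room for every claim from some step on
  have main : ∀ y, (∀ k n : ℕ, (k : ℝ) / ((n : ℝ) + 1) < f y → ∀ᶠ s in atTop,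
      childCoins (parentNode y) (coins Q s ++ coins Q s) +
        (k * 2 ^ (s + 1) / (n + 1) - (coins Q s ++ coins Q s).count y) ≤
          capacity (s + 1) (parentNode y) (coins Q s ++ coins Q s)) → f y ≤ trimmed Q y := by
    intro y hroom
    refine le_of_forall_frac_lt ((isSemimeasure_trimmed Q).nonneg y) fun k n hkn => ?_
    obtain ⟨s₀, hs₀⟩ := (hQ y k n).2 hkn
    obtain ⟨s₁, hs₁⟩ := eventually_atTop.1 (hroom k n hkn)
    refine le_of_forall_pos_le_add fun ε hε => ?_
    obtain ⟨s₂, hs₂⟩ := exists_pow_lt_of_lt_one hε (by norm_num : (1 : ℝ) / 2 < 1)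
    -- A step at which this claim comes up, late enough that it is accepted, that there is room, and
    -- that the rounding error of one coin is below `ε`.
    set s := Nat.pair (Encodable.encode (y, k, n)) (max s₀ (max s₁ s₂)) with hs
    have hle' : max s₀ (max s₁ s₂) ≤ s := Nat.right_le_pair _ _
    have hdec : (Encodable.decode s.unpair.1 : Option (List X × ℕ × ℕ)) = some (y, k, n) := by
      rw [hs, Nat.unpair_pair, Encodable.encodek]
    have hcoins := coins_succ_of_some (Q := Q) hdec
    have hq : Q (y, k, n) s = true := hmono _ s₀ s (by omega) hs₀
    unfold raiseCoins at hcoins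
    rw [if_pos ⟨hq, hs₁ s (by omega)⟩] at hcoins
    have hcount : k * 2 ^ (s + 1) / (n + 1) ≤ (coins Q (s + 1)).count y := by
      rw [hcoins, List.count_append, List.count_replicate_self]
      simp only
      omega
    have hfloor : (k : ℝ) * 2 ^ (s + 1) / ((n : ℝ) + 1) ≤ (coins Q (s + 1)).count y + 1 := by
      have h1 : k * 2 ^ (s + 1) < (k * 2 ^ (s + 1) / (n + 1) + 1) * (n + 1) := by
        rw [mul_comm _ (n + 1)]
        exact Nat.lt_mul_div_succ _ (Nat.succ_pos n)
      have h2 : k * 2 ^ (s + 1) ≤ ((coins Q (s + 1)).count y + 1) * (n + 1) :=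
        h1.le.trans (Nat.mul_le_mul_right _ (by omega))
      rw [div_le_iff₀ (by positivity)]
      exact_mod_cast h2
    have hval : (k : ℝ) / ((n : ℝ) + 1) ≤ coinValue Q (s + 1) y + (1 / 2) ^ (s + 1) := by
      unfold coinValue
      rw [one_div_pow, ← add_div, le_div_iff₀ (by positivity), ← mul_div_right_comm]
      exact hfloor
    have hpow : ((1 : ℝ) / 2) ^ (s + 1) ≤ (1 / 2) ^ s₂ :=
      pow_le_pow_of_le_one (by norm_num) (by norm_num) (by omega)
    linarith [hsup (s + 1) y]
  -- Induction down the tree: a node can be filled once its parent is nearly full, and the root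
  -- draws on the full supply.
  induction y using List.reverseRecOn with
  | nil =>
    refine main [] fun k n hkn => Eventually.of_forall fun s => ?_
    have h1 : k * 2 ^ (s + 1) / (n + 1) ≤ 2 ^ (s + 1) := by
      have hk : (k : ℝ) ≤ (n : ℝ) + 1 := by
        have := hkn.trans_le hf.nil_le
        rw [div_lt_one (by positivity)] at this
        exact this.le
      have hk' : k ≤ n + 1 := by exact_mod_cast hk
      exact Nat.div_le_of_le_mul (Nat.mul_le_mul_right _ hk')
    have h2 := childCoins_le_capacity_double (childCoins_le_capacity_coins Q s) none
    have h3 : parentNode ([] : List X) = none := rfl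
    rw [h3, ← childCoins_none] at *
    simp only [capacity, Option.elim] at *
    omega
  | append_singleton u a ih =>
    refine main (u ++ [a]) fun k n hkn => ?_
    -- The claim is strict, and this slack absorbs what the parent still lacks; the siblings never
    -- exceed their share under `f`.
    have hlim : ∀ᶠ s in atTop, f u - (f (u ++ [a]) - (k : ℝ) / ((n : ℝ) + 1)) < coinValue Q s u :=
      (tendsto_coinValue Q u).eventually_const_lt (by linarith)
    filter_upwards [hlim] with s hs
    have h3 : parentNode (u ++ [a]) = some u := by simp [parentNode]
    rw [h3]
    have hinv := childCoins_le_capacity_double (childCoins_le_capacity_coins Q s) (some u)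
    rcases le_total (k * 2 ^ (s + 1) / (n + 1)) ((coins Q s ++ coins Q s).count (u ++ [a])) with hT | hT
    · rwa [Nat.sub_eq_zero_of_le hT]
    · rw [← childCoins_some, ← Finset.add_sum_erase _ _ (Finset.mem_univ a)]
      have hcap : capacity (s + 1) (some u) (coins Q s ++ coins Q s)
          = (coins Q s ++ coins Q s).count u := rfl
      rw [hcap]
      have hcv : ∀ z, ((coins Q s ++ coins Q s).count z : ℝ) = coinValue Q s z * 2 ^ (s + 1) := by
        intro z
        unfold coinValue
        rw [List.count_append, pow_succ]
        push_cast
        field_simp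
        ring
      have hTr : ((k * 2 ^ (s + 1) / (n + 1) : ℕ) : ℝ) ≤
          (k : ℝ) / ((n : ℝ) + 1) * 2 ^ (s + 1) := by
        have h1 : ((k * 2 ^ (s + 1) / (n + 1) : ℕ) : ℝ) ≤
                ((k * 2 ^ (s + 1) : ℕ) : ℝ) / ((n + 1 : ℕ) : ℝ) := Nat.cast_div_le
        push_cast at h1
        rwa [mul_div_right_comm] at h1
      have hsib : ∑ b ∈ Finset.univ.erase a, coinValue Q s (u ++ [b]) ≤ f u - f (u ++ [a]) := by
        have h1 := hf.sum_le u
        rw [← Finset.add_sum_erase _ _ (Finset.mem_univ a)] at h1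
        have h2 : ∑ b ∈ Finset.univ.erase a, coinValue Q s (u ++ [b]) ≤
            ∑ b ∈ Finset.univ.erase a, f (u ++ [b]) := Finset.sum_le_sum fun b _ => hle s _
        linarith
      have goal : (k * 2 ^ (s + 1) / (n + 1)) +
          ∑ b ∈ Finset.univ.erase a, (coins Q s ++ coins Q s).count (u ++ [b]) ≤
          (coins Q s ++ coins Q s).count u := by
        have : ((k * 2 ^ (s + 1) / (n + 1) : ℕ) : ℝ) +
          ∑ b ∈ Finset.univ.erase a, ((coins Q s ++ coins Q s).count (u ++ [b]) : ℝ) ≤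
          ((coins Q s ++ coins Q s).count u : ℝ) := by
          simp only [hcv, ← Finset.sum_mul]
          refine (add_le_add_left hTr _).trans ?_
          rw [← add_mul]
          gcongr
          linarith
        exact_mod_cast this
      omega

theorem primrec_coins {α : Type*} [Primcodable α] {Q : α → List X × ℕ × ℕ → ℕ → Bool}
    (hQ : Primrec fun t : (α × List X × ℕ × ℕ) × ℕ => Q t.1.1 t.1.2 t.2) :
    Primrec₂ fun a s => coins (Q a) s := by
  have hpar : Primrec (parentNode : List X → Option (List X)) :=
    Primrec.ite (Primrec.eq.comp Primrec.id (Primrec.const [])) (Primrec.const none)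
      (Primrec.option_some.comp primrec_dropLast)
  have hchild : Primrec₂ (childCoins : Option (List X) → List (List X) → ℕ) :=
    primrec_list_count.comp Primrec.fst
      (Primrec.list_map Primrec.snd (hpar.comp Primrec.snd).to₂)
  have hcapa : Primrec fun t : (ℕ × Option (List X)) × List (List X) =>
      capacity t.1.1 t.1.2 t.2 :=
    (Primrec.option_casesOn (o := fun t : (ℕ × Option (List X)) × List (List X) => t.1.2)
      (f := fun t => 2 ^ t.1.1) (g := fun t u => t.2.count u)
      (Primrec.snd.comp Primrec.fst)
      (primrec_nat_pow.comp (Primrec.const 2) (Primrec.fst.comp Primrec.fst))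
      (primrec_list_count.comp Primrec.snd (Primrec.snd.comp Primrec.fst)).to₂).of_eq fun t => by
        obtain ⟨⟨s, _ | u⟩, L⟩ := t <;> rfl
  have hraise : Primrec fun t : (Bool × ℕ) × (List X × ℕ × ℕ) × List (List X) =>
      raiseCoins t.1.1 t.1.2 t.2.1 t.2.2 := by
    have hb : Primrec fun t : (Bool × ℕ) × (List X × ℕ × ℕ) × List (List X) => t.1.1 :=
      Primrec.fst.comp Primrec.fst
    have hs : Primrec fun t : (Bool × ℕ) × (List X × ℕ × ℕ) × List (List X) => t.1.2 :=
      Primrec.snd.comp Primrec.fst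
    have hc : Primrec fun t : (Bool × ℕ) × (List X × ℕ × ℕ) × List (List X) => t.2.1 :=
      Primrec.fst.comp Primrec.snd
    have hL : Primrec fun t : (Bool × ℕ) × (List X × ℕ × ℕ) × List (List X) => t.2.2 :=
      Primrec.snd.comp Primrec.snd
    have hz := Primrec.fst.comp hc
    have hp := hpar.comp hz
    have hk := Primrec.fst.comp (Primrec.snd.comp hc)
    have hn := Primrec.snd.comp (Primrec.snd.comp hc)
    have hT := Primrec.nat_sub.comp (Primrec.nat_div.comp
      (Primrec.nat_mul.comp hk (primrec_nat_pow.comp (Primrec.const 2) hs)) (Primrec.succ.comp hn))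
      (primrec_list_count.comp hz hL)
    exact Primrec.ite ((Primrec.eq.comp hb (Primrec.const true)).and
      (Primrec.nat_le.comp (Primrec.nat_add.comp (hchild.comp hp hL) hT)
        (hcapa.comp ((hs.pair hp).pair hL))))
      (Primrec.list_append.comp hL (primrec_replicate.comp hT hz)) hL
  have hrec : Primrec₂ fun (a : α) (s : ℕ) => (Nat.rec [] (fun s L =>
      ((Encodable.decode s.unpair.1 : Option (List X × ℕ × ℕ)).elim (L ++ L)
        fun c => raiseCoins (Q a c s) (s + 1) c (L ++ L))) s : List (List X)) := by
    refine Primrec.nat_rec (f := fun _ => []) (g := fun a (q : ℕ × List (List X)) =>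
      ((Encodable.decode q.1.unpair.1 : Option (List X × ℕ × ℕ)).elim (q.2 ++ q.2)
        fun c => raiseCoins (Q a c q.1) (q.1 + 1) c (q.2 ++ q.2))) (Primrec.const []) ?_
    have hL : Primrec fun t : α × ℕ × List (List X) => t.2.2 ++ t.2.2 :=
      Primrec.list_append.comp (Primrec.snd.comp Primrec.snd) (Primrec.snd.comp Primrec.snd)
    have hs : Primrec fun t : α × ℕ × List (List X) => t.2.1 := Primrec.fst.comp Primrec.snd
    refine (Primrec.option_casesOn (o := fun t : α × ℕ × List (List X) =>
        (Encodable.decode t.2.1.unpair.1 : Option (List X × ℕ × ℕ)))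
      (f := fun t => t.2.2 ++ t.2.2)
      (g := fun t c => raiseCoins (Q t.1 c t.2.1) (t.2.1 + 1) c (t.2.2 ++ t.2.2))
      (Primrec.decode.comp (Primrec.fst.comp (Primrec.unpair.comp hs))) hL ?_).of_eq ?_
    · have h1 : Primrec fun t : (α × ℕ × List (List X)) × (List X × ℕ × ℕ) =>
          Q t.1.1 t.2 t.1.2.1 :=
        hQ.comp (((Primrec.fst.comp Primrec.fst).pair Primrec.snd).pair (hs.comp Primrec.fst))
      exact hraise.comp ((h1.pair (Primrec.succ.comp (hs.comp Primrec.fst))).pair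
        (Primrec.snd.pair (hL.comp Primrec.fst)))
    · rintro ⟨a, s, L⟩
      cases h : (Encodable.decode s.unpair.1 : Option (List X × ℕ × ℕ)) <;> simp [h]
  refine hrec.of_eq fun a s => ?_
  induction s with
  | zero => rfl
  | succ s ih => simp only [coins, ← ih]

/-- Every recursively enumerable family of claims describes a uniformly lower computable family of
semimeasures, faithfully so where the claims do describe a semimeasure. -/
theorem exists_trimmed [Fintype X] {α : Type*} [Primcodable α] {W : α × List X × ℕ × ℕ → Prop}
    (hW : REPred W) :
    ∃ τ : α → List X → ℝ, (∀ a, IsSemimeasure (τ a)) ∧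
      (∃ φ : α × List X → ℕ → ℕ, Primrec₂ φ ∧ ∀ a,
        Monotone (fun s => (φ a s : ℝ) / 2 ^ s) ∧
        Tendsto (fun s => (φ a s : ℝ) / 2 ^ s) atTop (𝓝 (τ a.1 a.2))) ∧
      ∀ a f, IsSemimeasure f → (∀ y k n, W (a, y, k, n) ↔ (k : ℝ) / ((n : ℝ) + 1) < f y) →
        τ a = f := by
  obtain ⟨Q, hQ, hmono, hWQ⟩ := exists_primrec_stages_of_rePred hW
  refine ⟨fun a => trimmed fun c s => Q (a, c) s, fun a => isSemimeasure_trimmed _,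
    ⟨fun a s => (coins (fun c s => Q (a.1, c) s) s).count a.2, ?_, fun a => ⟨?_, ?_⟩⟩, ?_⟩
  · exact primrec_list_count.comp (Primrec.snd.comp Primrec.fst)
      ((primrec_coins (Q := fun a c s => Q (a, c) s) hQ).comp (Primrec.fst.comp Primrec.fst)
        Primrec.snd)
  · exact coinValue_mono _ _
  · exact tendsto_coinValue _ _
  · intro a f hf h
    have h' : ∀ y k n, (∃ s, Q (a, y, k, n) s = true) ↔ (k : ℝ) / ((n : ℝ) + 1) < f y := by
      intro y k n
      rw [← hWQ, h]
    funext y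
    refine le_antisymm ?_ (le_trimmed hf (fun c s t => hmono (a, c) s t) h' y)
    exact le_of_tendsto' (tendsto_coinValue _ y) fun s =>
      coinValue_le hf.nonneg (fun y k n s hs => (h' y k n).1 ⟨s, hs⟩) s y

end Trim

/-! ### Mixtures over the programs of a prefix machine -/

section Mix

variable {X : Type*} {U : List Bool × List X →. ℕ}

open Classical in
/-- The contribution of the program `p` to the mixture of the numbers `g i`. -/
noncomputable def mixTerm (U : List Bool × List X →. ℕ) (x : List X) (g : ℕ → ℝ) (p : List Bool) :
    ℝ :=
  if h : (U (p, x)).Dom then ((1 : ℝ) / 2) ^ p.length * g ((U (p, x)).get h) else 0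

/-- The mixture of the numbers `g i`, weighted by the programs that output `i` given `x`. -/
noncomputable def mix (U : List Bool × List X →. ℕ) (x : List X) (g : ℕ → ℝ) : ℝ :=
  ∑' p, mixTerm U x g p

theorem mixTerm_of_mem {x : List X} {p : List Bool} {i : ℕ} (h : i ∈ U (p, x)) (g : ℕ → ℝ) :
    mixTerm U x g p = ((1 : ℝ) / 2) ^ p.length * g i := by
  obtain ⟨h, rfl⟩ := h
  simp [mixTerm, h]

theorem mixTerm_nonneg {x : List X} {g : ℕ → ℝ} (hg : ∀ i, 0 ≤ g i) (p : List Bool) :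
    0 ≤ mixTerm U x g p := by
  unfold mixTerm
  split_ifs
  · exact mul_nonneg (by positivity) (hg _)
  · exact le_rfl

theorem mixTerm_mono {x : List X} {g g' : ℕ → ℝ} (hg : ∀ i, g i ≤ g' i) (p : List Bool) :
    mixTerm U x g p ≤ mixTerm U x g' p := by
  unfold mixTerm
  split_ifs
  · exact mul_le_mul_of_nonneg_left (hg _) (by positivity)
  · exact le_rfl

theorem sum_mixTerm {ι : Type*} (s : Finset ι) (x : List X) (g : ι → ℕ → ℝ) (p : List Bool) :
    ∑ a ∈ s, mixTerm U x (g a) p = mixTerm U x (fun i => ∑ a ∈ s, g a i) p := by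
  unfold mixTerm
  split_ifs
  · rw [Finset.mul_sum]
  · simp

variable [Primcodable X]

/-- The programs halting on the same side information are prefix-free, so Kraft bounds their total
weight. -/
theorem IsPrefixMachine.sum_mixTerm_le (hU : IsPrefixMachine U) (x : List X) {g : ℕ → ℝ}
    (hg : ∀ i, g i ≤ 1) (S : Finset (List Bool)) :
    ∑ p ∈ S, mixTerm U x g p ≤ 1 := by
  classical
  calc ∑ p ∈ S, mixTerm U x g p
      ≤ ∑ p ∈ S, if (U (p, x)).Dom then ((1 : ℝ) / 2) ^ p.length else 0 := by
        refine Finset.sum_le_sum fun p _ => ?_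
        unfold mixTerm
        split_ifs
        · exact mul_le_of_le_one_right (by positivity) (hg _)
        · exact le_rfl
    _ = ∑ p ∈ S with (U (p, x)).Dom, ((1 : ℝ) / 2) ^ p.length := (Finset.sum_filter _ _).symm
    _ ≤ 1 := by
        refine sum_length_le_one_of_prefixFree _ fun p hp q hq h => ?_
        exact hU.prefixFree x p q (Finset.mem_filter.1 hp).2 (Finset.mem_filter.1 hq).2 h

theorem IsPrefixMachine.summable_mixTerm (hU : IsPrefixMachine U) (x : List X) {g : ℕ → ℝ}
    (h0 : ∀ i, 0 ≤ g i) (h1 : ∀ i, g i ≤ 1) : Summable (mixTerm U x g) :=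
  summable_of_sum_le (mixTerm_nonneg h0) (hU.sum_mixTerm_le x h1)

theorem IsPrefixMachine.le_mix (hU : IsPrefixMachine U) {x : List X} {g : ℕ → ℝ}
    (h0 : ∀ i, 0 ≤ g i) (h1 : ∀ i, g i ≤ 1) {p : List Bool} {i : ℕ} (h : i ∈ U (p, x)) :
    ((1 : ℝ) / 2) ^ p.length * g i ≤ mix U x g := by
  rw [← mixTerm_of_mem h]
  exact (hU.summable_mixTerm x h0 h1).le_tsum p fun q _ => mixTerm_nonneg h0 q

theorem IsPrefixMachine.isSemimeasure_mix [Fintype X] (hU : IsPrefixMachine U) (x : List X)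
    {σ : ℕ → List X → ℝ} (hσ : ∀ i, IsSemimeasure (σ i)) :
    IsSemimeasure fun y => mix U x fun i => σ i y := by
  have hs : ∀ y, Summable (mixTerm U x fun i => σ i y) := fun y =>
    hU.summable_mixTerm x (fun i => (hσ i).nonneg y) fun i => (hσ i).le_one y
  refine IsSemimeasure.of_nil_le
    (fun y => tsum_nonneg (mixTerm_nonneg fun i => (hσ i).nonneg y)) ?_ fun y => ?_
  · exact Real.tsum_le_of_sum_le (mixTerm_nonneg fun i => (hσ i).nonneg [])
      (hU.sum_mixTerm_le x fun i => (hσ i).nil_le)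
  · unfold mix
    rw [← Summable.tsum_finsetSum fun a _ => hs (y ++ [a])]
    refine (summable_sum fun a _ => hs (y ++ [a])).tsum_le_tsum (fun p => ?_) (hs y)
    rw [sum_mixTerm]
    exact mixTerm_mono (fun i => (hσ i).sum_le y) p

/-- The approximation from below at stage `s` of the contribution of the program `p`. -/
noncomputable def mixStage (st : Option ℕ) (B s : ℕ) (p : List Bool) (φ : ℕ → ℕ) : ℝ :=
  -- The first condition leaves finitely many programs; the second makes `2^{-ℓ(p)}` an integer
  -- multiple of `2^{-s}`.
  if Encodable.encode p < s ∧ p.length ≤ s then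
    st.elim 0 fun i => ((1 : ℝ) / 2) ^ p.length * ((φ i : ℝ) / (B : ℝ) ^ s)
  else 0

theorem IsPrefixMachine.lowerComputable_mix (hU : IsPrefixMachine U)
    {σ : ℕ × List X → List X → ℝ} (h1 : ∀ t y, σ t y ≤ 1)
    (hσ : LowerComputable fun t : (ℕ × List X) × List X => σ t.1 t.2) :
    LowerComputable fun t : List X × List X => mix U t.1 fun i => σ (i, t.1) t.2 := by
  obtain ⟨B, φ, hB, hφ, hlim⟩ := hσ
  obtain ⟨st, hst, hmono, hmem⟩ := exists_primrec_stages hU.partrec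
  have hB' : (B : ℝ) ≠ 0 := by positivity
  have h0 : ∀ t y, 0 ≤ σ t y := fun t y =>
    ge_of_tendsto' (hlim (t, y)).2 fun s => by positivity
  -- Numerators over the common denominator `(2B)^s`, from `2^{-ℓ(p)} φ / B^s = 2^{s-ℓ(p)} φ /
  -- (2B)^s`.
  let N : (List X × List X) → ℕ → List Bool → ℕ := fun t s p =>
    if p.length ≤ s then
      (st (p, t.1) s).elim 0 fun i => 2 ^ (s - p.length) * φ ((i, t.1), t.2) s
    else 0
  let F : (List X × List X) → ℕ → List Bool → ℝ := fun t s p =>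
    mixStage (st (p, t.1) s) B s p fun i => φ ((i, t.1), t.2) s
  -- the approximation is a finite sum
  have hsum : ∀ t s, HasSum (F t s) (((∑ m ∈ Finset.range s,
      (Encodable.decode₂ (List Bool) m).elim 0 (N t s) : ℕ) : ℝ) / ((2 * B : ℕ) : ℝ) ^ s) := by
    intro t s
    have hinj : Function.Injective (Encodable.encode : List Bool → ℕ) := Encodable.encode_injective
    have hval : ∀ m ∈ Finset.range s, (((Encodable.decode₂ (List Bool) m).elim 0 (N t s) : ℕ) : ℝ)
        / ((2 * B : ℕ) : ℝ) ^ s = (Encodable.decode₂ (List Bool) m).elim 0 (F t s) := by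
      intro m hm
      cases h : Encodable.decode₂ (List Bool) m with
      | none => simp
      | some p =>
        have hp : Encodable.encode p < s := by
          rw [Encodable.decode₂_eq_some.1 h]; exact Finset.mem_range.1 hm
        simp only [Option.elim, N, F, mixStage, hp, true_and]
        split_ifs with hl
        · cases st (p, t.1) s with
          | none => simp
          | some i =>
            simp only
            push_cast
            rw [mul_pow, one_div_pow, mul_div_mul_comm]
            congr 1
            rw [div_eq_div_iff (by positivity) (by positivity), ← pow_add, one_mul]
            congr 1
            omega
        · simp
    rw [Nat.cast_sum, Finset.sum_div, Finset.sum_congr rfl hval]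
    have hz : ∀ m, m ∉ Finset.range s → (Encodable.decode₂ (List Bool) m).elim 0 (F t s) = 0 := by
      intro m hm
      cases h : Encodable.decode₂ (List Bool) m with
      | none => rfl
      | some p =>
        have hp : ¬ Encodable.encode p < s := by
          rw [Encodable.decode₂_eq_some.1 h]; exact fun h' => hm (Finset.mem_range.2 h')
        simp [F, mixStage, hp]
    -- As `decode₂` is `none` off the range of `encode`, a sum over codes counts each program
    -- exactly once.
    have := hasSum_sum_of_ne_finset_zero (L := SummationFilter.unconditional ℕ) hz
    rw [← hinj.hasSum_iff] at this
    · simpa only [Function.comp_def, Encodable.decode₂_encode, Option.elim] using this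
    · intro m hm
      cases h : Encodable.decode₂ (List Bool) m with
      | none => rfl
      | some p => exact absurd ⟨p, Encodable.decode₂_eq_some.1 h⟩ hm
  have hFmono : ∀ t p, Monotone fun s => F t s p := by
    intro t p s s' hs
    simp only [F, mixStage]
    by_cases hc : Encodable.encode p < s ∧ p.length ≤ s
    · rw [if_pos hc, if_pos ⟨hc.1.trans_le hs, hc.2.trans hs⟩]
      cases h : st (p, t.1) s with
      | none =>
        simp only [Option.elim]
        split <;> positivity
      | some i =>
        have h' : st (p, t.1) s' = some i := hmono _ s s' i hs h
        simp only [h', Option.elim]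
        exact mul_le_mul_of_nonneg_left ((hlim ((i, t.1), t.2)).1 hs) (by positivity)
    · rw [if_neg hc]
      split_ifs
      · cases st (p, t.1) s' <;> simp only [Option.elim] <;> positivity
      · exact le_rfl
  have hFlim : ∀ t p, Tendsto (fun s => F t s p) atTop
      (𝓝 (mixTerm U t.1 (fun i => σ (i, t.1) t.2) p)) := by
    intro t p
    by_cases hd : ∃ i, i ∈ U (p, t.1)
    · obtain ⟨i, hi⟩ := hd
      rw [mixTerm_of_mem hi]
      obtain ⟨s₀, hs₀⟩ := (hmem _ _).1 hi
      refine ((hlim ((i, t.1), t.2)).2.const_mul _).congr' ?_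
      filter_upwards [eventually_ge_atTop s₀, eventually_gt_atTop (Encodable.encode p),
        eventually_ge_atTop p.length] with s h1 h2 h3
      have h' : st (p, t.1) s = some i := hmono _ s₀ s i h1 hs₀
      simp [F, mixStage, h2, h3, h']
    · have hz : mixTerm U t.1 (fun i => σ (i, t.1) t.2) p = 0 := by
        unfold mixTerm
        exact dif_neg fun h => hd ⟨_, Part.get_mem h⟩
      rw [hz]
      refine tendsto_const_nhds.congr fun s => ?_
      have h' : st (p, t.1) s = none := by
        by_contra hne
        obtain ⟨i, hi⟩ := Option.ne_none_iff_exists'.1 hne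
        exact hd ⟨i, (hmem _ _).2 ⟨s, hi⟩⟩
      simp [F, mixStage, h']
  have hF0 : ∀ t s p, 0 ≤ F t s p := fun t s p => by
    simp only [F, mixStage]
    split_ifs
    · cases st (p, t.1) s <;> simp only [Option.elim] <;> positivity
    · exact le_rfl
  have hFle : ∀ t s p, F t s p ≤ mixTerm U t.1 (fun i => σ (i, t.1) t.2) p := fun t s p =>
    (hFmono t p).ge_of_tendsto (hFlim t p) s
  have hsummable : ∀ t : List X × List X, Summable (mixTerm U t.1 fun i => σ (i, t.1) t.2) :=
    fun t => hU.summable_mixTerm t.1 (fun i => h0 _ _) fun i => h1 _ _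
  refine ⟨2 * B, fun t s => ∑ m ∈ Finset.range s,
    (Encodable.decode₂ (List Bool) m).elim 0 (N t s), by omega, ?_, fun t => ⟨?_, ?_⟩⟩
  · refine primrec_sum_range (f := fun q : (List X × List X) × ℕ => q.2)
      (g := fun q m => (Encodable.decode₂ (List Bool) m).elim 0 (N q.1 q.2)) Primrec.snd ?_
    refine (Primrec.option_casesOn
      (o := fun q : ((List X × List X) × ℕ) × ℕ => Encodable.decode₂ (List Bool) q.2)
      (f := fun _ => 0) (g := fun q p => N q.1.1 q.1.2 p) (Primrec.decode₂.comp Primrec.snd)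
      (Primrec.const 0) ?_).of_eq ?_
    · have ht : Primrec fun q : (((List X × List X) × ℕ) × ℕ) × List Bool => q.1.1.1 :=
        Primrec.fst.comp (Primrec.fst.comp Primrec.fst)
      have hs : Primrec fun q : (((List X × List X) × ℕ) × ℕ) × List Bool => q.1.1.2 :=
        Primrec.snd.comp (Primrec.fst.comp Primrec.fst)
      have hl : Primrec fun q : (((List X × List X) × ℕ) × ℕ) × List Bool => q.2.length :=
        Primrec.list_length.comp Primrec.snd
      refine Primrec.ite (Primrec.nat_le.comp hl hs) ?_ (Primrec.const 0)
      refine (Primrec.option_casesOn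
        (o := fun q : (((List X × List X) × ℕ) × ℕ) × List Bool => st (q.2, q.1.1.1.1) q.1.1.2)
        (f := fun _ => 0)
        (g := fun q i => 2 ^ (q.1.1.2 - q.2.length) * φ ((i, q.1.1.1.1), q.1.1.1.2) q.1.1.2)
        (hst.comp (Primrec.snd.pair (Primrec.fst.comp ht)) hs) (Primrec.const 0) ?_).of_eq ?_
      · exact Primrec.nat_mul.comp
          (primrec_nat_pow.comp (Primrec.const 2)
            ((Primrec.nat_sub.comp hs hl).comp Primrec.fst))
          (hφ.comp ((Primrec.snd.pair ((Primrec.fst.comp ht).comp Primrec.fst)).pair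
            ((Primrec.snd.comp ht).comp Primrec.fst)) (hs.comp Primrec.fst))
      · rintro ⟨⟨⟨t, s⟩, m⟩, p⟩
        cases st (p, t.1) s <;> rfl
    · rintro ⟨⟨t, s⟩, m⟩
      cases h : Encodable.decode₂ (List Bool) m <;> simp [h]
  · intro s s' hs
    simp only [← (hsum t _).tsum_eq]
    exact (hsum t s).summable.tsum_le_tsum (fun p => hFmono t p hs) (hsum t s').summable
  · simp only [← (hsum t _).tsum_eq]
    -- The stages increase, so their own limit is a summable dominating function.
    refine tendsto_tsum_of_dominated_convergence (hsummable t) (hFlim t)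
      (Eventually.of_forall fun s p => ?_)
    rw [Real.norm_of_nonneg (hF0 t s p)]
    exact hFle t s p

end Mix

/-! ### Domination by the universal mixture and the splice at a given length. -/

section Mixture

variable {X : Type*} [Primcodable X] {U : List Bool × List X →. ℕ}

/-- An index speaks only about nonnegative fractions, hence the sign conditions. -/
theorem IsIndex.unique {i : ℕ} {f g : List X → ℝ} (hf : IsIndex i f) (hg : IsIndex i g)
    (hf0 : ∀ x, 0 ≤ f x) (hg0 : ∀ x, 0 ≤ g x) : f = g := by
  funext x
  exact le_antisymm
    (le_of_forall_frac_lt (hg0 x) fun k n h => ((hg x k n).1 ((hf x k n).2 h)).le)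
    (le_of_forall_frac_lt (hf0 x) fun k n h => ((hf x k n).1 ((hg x k n).2 h)).le)

theorem rePred_isIndex : REPred fun t : ℕ × List X × ℕ × ℕ =>
    ((Denumerable.ofNat Nat.Partrec.Code t.1).eval (Encodable.encode t.2)).Dom :=
  (Nat.Partrec.Code.eval_part.comp ((Computable.ofNat _).comp Computable.fst)
    (Computable.encode.comp Computable.snd)).dom_re

variable [Fintype X]

/-- The terms of the universal mixture are among the terms of the mixture over all programs. -/
theorem IsUniversal.exists_injective_mixTerm (hU : IsUniversal U) {τ : ℕ → List X → ℝ}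
    (hτ : ∀ i f, IsSemimeasure f → IsIndex i f → τ i = f) :
    ∃ r : {ν : List X → ℝ // IsSemimeasure ν ∧ Enumerable ν} → List Bool, Function.Injective r ∧
      ∀ x ν, mixTerm U [] (fun i => τ i x) (r ν) =
        ((1 : ℝ) / 2) ^ condKFun U ν.1 [] * ν.1 x := by
  choose i hi hK using fun ν : {ν : List X → ℝ // IsSemimeasure ν ∧ Enumerable ν} =>
    exists_isIndex_condK_eq (U := U) ν.2.2 []
  choose r hr hmem using fun ν => hU.exists_length_eq_condK (i ν) []
  refine ⟨r, fun ν ν' h => ?_, fun x ν => ?_⟩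
  -- A program has one output, and an index belongs to one nonnegative function.
  · have h1 := hmem ν
    rw [h] at h1
    have hii : i ν = i ν' := Part.mem_unique h1 (hmem ν')
    exact Subtype.ext ((hi ν).unique (hii ▸ hi ν') ν.2.1.nonneg ν'.2.1.nonneg)
  · rw [mixTerm_of_mem (hmem ν), hr, hK, hτ (i ν) ν.1 ν.2.1 (hi ν)]

/-- Without summability the `tsum` in `mixture` would be the default `0`, and no single term would
bound it from below. -/
theorem IsUniversal.summable_mixture (hU : IsUniversal U) {τ : ℕ → List X → ℝ}
    (hs : ∀ i, IsSemimeasure (τ i)) (hτ : ∀ i f, IsSemimeasure f → IsIndex i f → τ i = f)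
    (x : List X) : Summable fun ν : {ν : List X → ℝ // IsSemimeasure ν ∧ Enumerable ν} =>
      ((1 : ℝ) / 2) ^ condKFun U ν.1 [] * ν.1 x := by
  obtain ⟨r, hr, h⟩ := hU.exists_injective_mixTerm hτ
  simp only [← h x]
  exact (hU.isPrefixMachine.summable_mixTerm [] (fun i => (hs i).nonneg x)
    fun i => (hs i).le_one x).comp_injective hr

/-- The right side counts every halting program instead of one shortest program per function. This
makes it enumerable, and an upper bound for the mixture is all that the splice needs. -/
theorem IsUniversal.mixture_le_mix (hU : IsUniversal U) {τ : ℕ → List X → ℝ}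
    (hs : ∀ i, IsSemimeasure (τ i)) (hτ : ∀ i f, IsSemimeasure f → IsIndex i f → τ i = f)
    (x : List X) : mixture U x ≤ mix U [] fun i => τ i x := by
  obtain ⟨r, hr, h⟩ := hU.exists_injective_mixTerm hτ
  have hsum := hU.summable_mixture hs hτ x
  unfold mixture mix
  exact hsum.tsum_le_tsum_of_inj r hr (fun p _ => mixTerm_nonneg (fun i => (hs i).nonneg x) p)
    (fun ν => (h x ν).ge) (hU.isPrefixMachine.summable_mixTerm [] (fun i => (hs i).nonneg x)
      fun i => (hs i).le_one x)

/-- Every number is turned into a semimeasure, whether or not it is an index of one, so outputs of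
programs can be used without inspection. -/
theorem exists_trimmed_index :
    ∃ τ : ℕ → List X → ℝ, (∀ i, IsSemimeasure (τ i)) ∧
      (∃ φ : ℕ × List X → ℕ → ℕ, Primrec₂ φ ∧ ∀ a,
        Monotone (fun s => (φ a s : ℝ) / 2 ^ s) ∧
        Tendsto (fun s => (φ a s : ℝ) / 2 ^ s) atTop (𝓝 (τ a.1 a.2))) ∧
      ∀ i f, IsSemimeasure f → IsIndex i f → τ i = f := by
  classical
  exact exists_trimmed rePred_isIndex

/-- A program for `n` followed by the computable map from `n` to an index of `ν n` is again a prefix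
machine. -/
theorem condKFun_le_plainK {X : Type*} [Primcodable X] {U : List Bool × List X →. ℕ}
    (hU : IsUniversal U) {ν : ℕ → List X → ℝ}
    (hν : REPred fun t : ℕ × List X × ℕ × ℕ => (t.2.2.1 : ℝ) / ((t.2.2.2 : ℝ) + 1) < ν t.1 t.2.1) :
    ∃ c, ∀ n, condKFun U (ν n) [] ≤ plainK U n + c := by
  obtain ⟨j, hj, hidx⟩ := exists_isIndex_family hν
  let T : List Bool × List X →. ℕ := fun t => (U (t.1, [])).map j
  have hT : IsPrefixMachine T := by
    refine ⟨?_, fun x p q hp hq h => hU.isPrefixMachine.prefixFree [] p q hp hq h⟩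
    exact (hU.isPrefixMachine.partrec.comp
      (Computable.fst.pair (Computable.const []))).map (hj.comp Computable.snd).to₂
  obtain ⟨c, hc⟩ := hU.optimal T hT
  refine ⟨c, fun n => ?_⟩
  obtain ⟨p, hp, hmem⟩ := hU.exists_length_eq_condK n []
  obtain ⟨q, hq, hq'⟩ := hc p [] (j n) (Part.mem_map j hmem)
  have h1 := condKFun_le (U := U) (hidx n) []
  have h2 := condK_le hq'
  unfold plainK
  omega

/-- The universal mixture dominates uniformly enumerable families of semimeasures. -/
theorem IsUniversal.exists_le_mixture (hU : IsUniversal U) {ν : ℕ → List X → ℝ}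
    (hs : ∀ n, IsSemimeasure (ν n))
    (hν : REPred fun t : ℕ × List X × ℕ × ℕ => (t.2.2.1 : ℝ) / ((t.2.2.2 : ℝ) + 1) < ν t.1 t.2.1) :
    ∃ c, ∀ n z, ((1 : ℝ) / 2) ^ (plainK U n + c) * ν n z ≤ mixture U z := by
  obtain ⟨c, hc⟩ := condKFun_le_plainK hU hν
  obtain ⟨τ, hτs, -, hτ⟩ := exists_trimmed_index (X := X)
  refine ⟨c, fun n z => ?_⟩
  have hg : Computable fun t : List X × ℕ × ℕ => (n, t) :=
    ((Primrec.const n).pair Primrec.id).to_comp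
  have henum : Enumerable (ν n) := (REPred.comp hν hg).of_eq fun t => Iff.rfl
  have hterm := (hU.summable_mixture hτs hτ z).le_tsum ⟨ν n, hs n, henum⟩
    fun ν' _ => mul_nonneg (by positivity) (ν'.2.1.nonneg z)
  calc ((1 : ℝ) / 2) ^ (plainK U n + c) * ν n z
      ≤ ((1 : ℝ) / 2) ^ condKFun U (ν n) [] * ν n z := by
        refine mul_le_mul_of_nonneg_right ?_ ((hs n).nonneg z)
        exact pow_le_pow_of_le_one (by norm_num) (by norm_num) (hc n)
    _ ≤ mixture U z := hterm

/-- Continue the semimeasure `ρ` after `n` symbols with the kernel `κ`. -/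
theorem isSemimeasure_splice {X : Type*} [Fintype X] {ρ : List X → ℝ} {κ : List X → List X → ℝ} (hρ : IsSemimeasure ρ)
    (hκ : ∀ x, IsSemimeasure (κ x)) (n : ℕ) :
    IsSemimeasure fun z => if z.length < n then ρ z else ρ (z.take n) * κ (z.take n) (z.drop n) := by
  have hle : ∀ x y, ρ x * κ x y ≤ ρ x := fun x y =>
    mul_le_of_le_one_right (hρ.nonneg x) ((hκ x).le_one y)
  refine IsSemimeasure.of_nil_le (fun z => ?_) ?_ fun z => ?_
  · split_ifs
    · exact hρ.nonneg z
    · exact mul_nonneg (hρ.nonneg _) ((hκ _).nonneg _)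
  · split_ifs
    · exact hρ.nil_le
    · exact (hle _ _).trans (hρ.le_one _)
  · by_cases hz : z.length < n
    · simp only [hz, if_true]
      refine (Finset.sum_le_sum fun a _ => ?_).trans (hρ.sum_le z)
      split_ifs with h
      · exact le_rfl
      -- Crossing from length `n - 1` to `n`, the new factor is the kernel at `[]`, which is at most
      -- `1`.
      · rw [List.take_of_length_le (by simp; omega)]
        exact hle _ _
    · have h' : ∀ a : X, ¬ (z ++ [a]).length < n := fun a => by simp; omega
      simp only [hz, h', if_false]
      have ht : ∀ a : X, (z ++ [a]).take n = z.take n := fun a =>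
        List.take_append_of_le_length (by omega)
      have hd : ∀ a : X, (z ++ [a]).drop n = z.drop n ++ [a] := fun a =>
        List.drop_append_of_le_length (by omega)
      simp only [ht, hd, ← Finset.mul_sum]
      exact mul_le_mul_of_nonneg_left ((hκ _).sum_le _) (hρ.nonneg _)

/-- The universal mixture, conditioned on `x`, dominates uniformly lower computable families of
semimeasures that depend on `x`. -/
theorem IsUniversal.exists_mul_mixture_le (hU : IsUniversal U) {σ : ℕ × List X → List X → ℝ}
    (hs : ∀ t, IsSemimeasure (σ t))
    (hσ : LowerComputable fun t : (ℕ × List X) × List X => σ t.1 t.2) :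
    ∃ c, ∀ i x y, ((1 : ℝ) / 2) ^ (condK U i x + plainK U x.length + c) *
      (mixture U x * σ (i, x) y) ≤ mixture U (x ++ y) := by
  obtain ⟨τ, hτs, ⟨φ, hφ, hφlim⟩, hτ⟩ := exists_trimmed_index (X := X)
  have hUp := hU.isPrefixMachine
  let ρ : List X → ℝ := fun z => mix U [] fun i => τ i z
  let κ : List X → List X → ℝ := fun x y => mix U x fun i => σ (i, x) y
  have hρ : IsSemimeasure ρ := hUp.isSemimeasure_mix [] hτs
  have hκ : ∀ x, IsSemimeasure (κ x) := fun x => hUp.isSemimeasure_mix x fun i => hs (i, x)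
  have hρc : LowerComputable ρ := by
    have h1 : LowerComputable fun t : (ℕ × List X) × List X => τ t.1.1 t.2 :=
      ⟨2, fun t s => φ (t.1.1, t.2) s, by norm_num,
        hφ.comp (((Primrec.fst.comp Primrec.fst).comp Primrec.fst).pair
          (Primrec.snd.comp Primrec.fst)) Primrec.snd, fun t => by
            simpa using hφlim (t.1.1, t.2)⟩
    have h2 := hUp.lowerComputable_mix (σ := fun t : ℕ × List X => τ t.1)
      (fun t y => (hτs t.1).le_one y) h1
    exact h2.comp ((Primrec.const []).pair Primrec.id)
  have hκc : LowerComputable fun t : List X × List X => κ t.1 t.2 :=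
    hUp.lowerComputable_mix (fun t y => (hs t).le_one y) hσ
  -- The prefix fed to `κ` is read off from `z` itself, so `n` is the only parameter of the family.
  let ν : ℕ → List X → ℝ := fun n z =>
    if z.length < n then ρ z else ρ (z.take n) * κ (z.take n) (z.drop n)
  have hνc : LowerComputable fun t : ℕ × List X => ν t.1 t.2 := by
    have ht : Primrec fun t : ℕ × List X => t.2.take t.1 :=
      Primrec.list_take.comp Primrec.fst Primrec.snd
    have hd : Primrec fun t : ℕ × List X => t.2.drop t.1 :=
      Primrec.list_drop.comp Primrec.fst Primrec.snd
    exact LowerComputable.ite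
      (Primrec.nat_lt.comp (Primrec.list_length.comp Primrec.snd) Primrec.fst)
      (hρc.comp Primrec.snd) ((hρc.comp ht).mul (hκc.comp (ht.pair hd)))
  have hνre : REPred fun t : ℕ × List X × ℕ × ℕ =>
      (t.2.2.1 : ℝ) / ((t.2.2.2 : ℝ) + 1) < ν t.1 t.2.1 :=
    REPred.comp hνc.rePred (f := fun t : ℕ × List X × ℕ × ℕ => ((t.1, t.2.1), t.2.2))
      ((Primrec.fst.pair (Primrec.fst.comp Primrec.snd)).pair
        (Primrec.snd.comp Primrec.snd)).to_comp
  obtain ⟨c, hc⟩ := hU.exists_le_mixture (fun n => isSemimeasure_splice hρ hκ n) hνre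
  refine ⟨c, fun i x y => le_trans ?_ (hc x.length (x ++ y))⟩
  have hν : ν x.length (x ++ y) = ρ x * κ x y := by simp [ν]
  have e : (if (x ++ y).length < x.length then ρ (x ++ y) else
      ρ ((x ++ y).take x.length) * κ ((x ++ y).take x.length) ((x ++ y).drop x.length))
      = ρ x * κ x y := hν
  rw [e]
  obtain ⟨p, hp, hmem⟩ := hU.exists_length_eq_condK i x
  have h1 : ((1 : ℝ) / 2) ^ condK U i x * σ (i, x) y ≤ κ x y := by
    rw [← hp]
    exact hUp.le_mix (g := fun i => σ (i, x) y) (fun i => (hs _).nonneg y)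
      (fun i => (hs _).le_one y) hmem
  have h2 : mixture U x ≤ ρ x := hU.mixture_le_mix hτs hτ x
  have h3 : 0 ≤ mixture U x := tsum_nonneg fun ν => mul_nonneg (by positivity) (ν.2.1.nonneg x)
  calc ((1 : ℝ) / 2) ^ (condK U i x + plainK U x.length + c) * (mixture U x * σ (i, x) y)
      = ((1 : ℝ) / 2) ^ (plainK U x.length + c) *
          (mixture U x * (((1 : ℝ) / 2) ^ condK U i x * σ (i, x) y)) := by
        rw [add_assoc, pow_add]; ring
    _ ≤ _ := by
        refine mul_le_mul_of_nonneg_left ?_ (by positivity)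
        exact mul_le_mul h2 h1 (mul_nonneg (by positivity) ((hs _).nonneg y)) (hρ.nonneg x)

end Mixture

/-! ### Enumerating conditional probabilities from an index of the measure. -/

section Conditional

variable {X : Type*} [Fintype X]

/-- The list of all strings of length `n`. -/
noncomputable def allStrings (X : Type*) [Fintype X] : ℕ → List (List X)
  | 0 => [[]]
  | n + 1 => (allStrings X n).flatMap fun z => (Finset.univ : Finset X).toList.map fun a => z ++ [a]

theorem mem_allStrings (x : List X) : x ∈ allStrings X x.length := by
  induction x using List.reverseRecOn with
  | nil => simp [allStrings]
  | append_singleton u a ih =>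
    simp only [List.length_append, List.length_singleton, allStrings, List.mem_flatMap]
    exact ⟨u, ih, by simp⟩

theorem IsMeasure.sum_allStrings {μ : List X → ℝ} (h : IsMeasure μ) (n : ℕ) :
    ((allStrings X n).map μ).sum = 1 := by
  induction n with
  | zero => simp [allStrings, h.nil_eq]
  | succ n ih =>
    rw [← ih, allStrings]
    induction allStrings X n with
    | nil => simp
    | cons z l ihl =>
      simp only [List.flatMap_cons, List.map_append, List.sum_append, ihl, List.map_cons,
        List.sum_cons, List.map_map]
      congr 1
      rw [← h.sum_eq z, ← Finset.sum_map_toList]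
      rfl

variable [Primcodable X]

theorem primrec_allStrings : Primrec (allStrings X) :=
  (Primrec.nat_rec₁ (f := fun (_ : ℕ) (l : List (List X)) =>
      l.flatMap fun z => (Finset.univ : Finset X).toList.map fun a => z ++ [a]) [[]]
    (Primrec.list_flatMap Primrec.snd
      (Primrec.list_map (Primrec.const _)
        (Primrec.list_concat.comp (Primrec.snd.comp Primrec.fst) Primrec.snd).to₂).to₂).to₂).of_eq
    fun n => by
      induction n with
      | zero => rfl
      | succ n ih => simp only [allStrings, ← ih]

/-- Where a computable measure is positive, its conditional probabilities are enumerable from an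
index of the measure: it is enumerable from above, being `1` minus the rest of its level. -/
theorem exists_enumeration_conditional :
    ∃ W : (ℕ × List X) × List X × ℕ × ℕ → Prop, REPred W ∧ ∀ i μ, IsMeasure μ → IsIndex i μ →
      ∀ x, μ x ≠ 0 → ∀ (y : List X) (k n : ℕ),
        (W ((i, x), y, k, n) ↔ (k : ℝ) / ((n : ℝ) + 1) < μ (x ++ y) / μ x) := by
  obtain ⟨τ, -, ⟨φ, hφ, hlim⟩, hτ⟩ := exists_trimmed_index (X := X)
  -- This is `k μ(x) < (n + 1) μ(xy)` with `μ(x)` written as `1` minus the rest of its level, at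
  -- stage `s` and multiplied by `2 ^ s`. The term `k φ(x)` on the left cancels the entry of `x` in
  -- the sum over the whole level.
  refine ⟨fun t => ∃ s, t.2.2.1 * 2 ^ s + t.2.2.1 * φ t.1 s <
    (t.2.2.2 + 1) * φ (t.1.1, t.1.2 ++ t.2.1) s +
      t.2.2.1 * ((allStrings X t.1.2.length).map fun z => φ (t.1.1, z) s).sum, ?_, ?_⟩
  · refine rePred_exists ?_
    have hi : Primrec fun q : ((ℕ × List X) × List X × ℕ × ℕ) × ℕ => q.1.1.1 :=
      Primrec.fst.comp (Primrec.fst.comp Primrec.fst)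
    have hx : Primrec fun q : ((ℕ × List X) × List X × ℕ × ℕ) × ℕ => q.1.1.2 :=
      Primrec.snd.comp (Primrec.fst.comp Primrec.fst)
    have h2 : Primrec fun q : ((ℕ × List X) × List X × ℕ × ℕ) × ℕ => q.1.2 :=
      Primrec.snd.comp Primrec.fst
    have hy := Primrec.fst.comp h2
    have hk := Primrec.fst.comp (Primrec.snd.comp h2)
    have hn := Primrec.snd.comp (Primrec.snd.comp h2)
    have hs : Primrec fun q : ((ℕ × List X) × List X × ℕ × ℕ) × ℕ => q.2 := Primrec.snd
    refine Primrec.nat_lt.comp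
      (Primrec.nat_add.comp
        (Primrec.nat_mul.comp hk (primrec_nat_pow.comp (Primrec.const 2) hs))
        (Primrec.nat_mul.comp hk (hφ.comp (Primrec.fst.comp Primrec.fst) hs)))
      (Primrec.nat_add.comp
        (Primrec.nat_mul.comp (Primrec.succ.comp hn)
          (hφ.comp (hi.pair (Primrec.list_append.comp hx hy)) hs))
        (Primrec.nat_mul.comp hk (primrec_list_sum_map
          (primrec_allStrings.comp (Primrec.list_length.comp hx))
          (hφ.comp ((hi.comp Primrec.fst).pair Primrec.snd) (hs.comp Primrec.fst)).to₂)))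
  · intro i μ hμ hidx x hx y k n
    have hpos : 0 < μ x := lt_of_le_of_ne (hμ.nonneg x) (Ne.symm hx)
    have hv : ∀ z, Monotone (fun s => (φ (i, z) s : ℝ) / 2 ^ s) ∧
        Tendsto (fun s => (φ (i, z) s : ℝ) / 2 ^ s) atTop (𝓝 (μ z)) := by
      intro z
      rw [← hτ i μ hμ.isSemimeasure hidx]
      exact hlim (i, z)
    obtain ⟨rest, hperm⟩ : ∃ rest, (allStrings X x.length).Perm (x :: rest) := by
      obtain ⟨l₁, l₂, h⟩ := List.append_of_mem (mem_allStrings x)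
      exact ⟨l₁ ++ l₂, h ▸ List.perm_middle⟩
    let u : ℕ → ℝ := fun s => ((n : ℝ) + 1) * ((φ (i, x ++ y) s : ℝ) / 2 ^ s) +
      k * (rest.map fun z => (φ (i, z) s : ℝ) / 2 ^ s).sum
    have hrest : (rest.map μ).sum = 1 - μ x := by
      rw [← hμ.sum_allStrings x.length, (hperm.map μ).sum_eq, List.map_cons, List.sum_cons]
      ring
    have hu : Tendsto u atTop (𝓝 (((n : ℝ) + 1) * μ (x ++ y) + k * (1 - μ x))) := by
      rw [← hrest]
      exact ((hv _).2.const_mul _).add ((tendsto_list_sum _ fun z _ => (hv z).2).const_mul _)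
    have humono : Monotone u := fun s t hst => by
      refine add_le_add (mul_le_mul_of_nonneg_left ((hv _).1 hst) (by positivity))
        (mul_le_mul_of_nonneg_left ?_ (by positivity))
      exact List.sum_le_sum fun z _ => (hv z).1 hst
    have key : ∀ s, (k * 2 ^ s + k * φ (i, x) s < (n + 1) * φ (i, x ++ y) s +
        k * ((allStrings X x.length).map fun z => φ (i, z) s).sum) ↔ (k : ℝ) < u s := by
      intro s
      have e : ∀ l : List (List X), (l.map fun z => (φ (i, z) s : ℝ) / 2 ^ s).sum =
          ((l.map fun z => φ (i, z) s).sum : ℕ) / 2 ^ s := fun l => by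
        induction l with
        | nil => simp
        | cons z l ih => simp only [List.map_cons, List.sum_cons, ih]; push_cast; ring
      have e' : u s = (((n + 1) * φ (i, x ++ y) s +
          k * (rest.map fun z => φ (i, z) s).sum : ℕ) : ℝ) / 2 ^ s := by
        simp only [u]
        rw [e]
        push_cast
        ring
      rw [e', lt_div_iff₀ (by positivity),
        (hperm.map fun z => φ (i, z) s).sum_eq, List.map_cons, List.sum_cons]
      have : ((k : ℝ) * 2 ^ s) = ((k * 2 ^ s : ℕ) : ℝ) := by push_cast; rfl
      rw [this, Nat.cast_lt, mul_add]
      omega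
    have hiff : (∃ s, (k : ℝ) < u s) ↔ (k : ℝ) < ((n : ℝ) + 1) * μ (x ++ y) + k * (1 - μ x) :=
      ⟨fun ⟨s, hs⟩ => hs.trans_le (humono.ge_of_tendsto hu s),
        fun h => (hu.eventually_const_lt h).exists⟩
    simp only [key, hiff]
    rw [div_lt_div_iff₀ (by positivity) hpos]
    constructor <;> intro h <;> nlinarith

/-- Trimming lets `W` be arbitrary at the pairs `(i, x)` where it describes no semimeasure. -/
theorem IsUniversal.exists_of_enumeration {U : List Bool × List X →. ℕ} (hU : IsUniversal U)
    {W : (ℕ × List X) × List X × ℕ × ℕ → Prop} (hW : REPred W) :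
    ∃ c, ∀ i x f, IsSemimeasure f →
      (∀ y k n, W ((i, x), y, k, n) ↔ (k : ℝ) / ((n : ℝ) + 1) < f y) → ∀ y,
      ((1 : ℝ) / 2) ^ (condK U i x + plainK U x.length + c) * (mixture U x * f y) ≤
        mixture U (x ++ y) := by
  classical
  obtain ⟨τ, hs, ⟨φ, hφ, hlim⟩, hτ⟩ := exists_trimmed hW
  obtain ⟨c, hc⟩ := hU.exists_mul_mixture_le hs
    ⟨2, φ, by norm_num, hφ, fun a => by simpa using hlim a⟩
  refine ⟨c, fun i x f hf h y => ?_⟩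
  rw [← hτ (i, x) f hf h]
  exact hc i x y

end Conditional

/-! ### From domination to the logarithmic bound. -/

theorem mixture_nonneg {X : Type*} [Fintype X] [Primcodable X] (U : List Bool × List X →. ℕ)
    (x : List X) : 0 ≤ mixture U x :=
  tsum_nonneg fun ν => mul_nonneg (by positivity) (ν.2.1.nonneg x)

theorem logb_div_div_le {v m m' : ℝ} {N : ℕ} (hv : 0 ≤ v) (hm : 0 ≤ m) (hm' : 0 ≤ m')
    (h : ((1 : ℝ) / 2) ^ N * (m * v) ≤ m') : Real.logb 2 (v / (m' / m)) ≤ N := by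
  -- A vanishing quotient, including one that comes from division by zero, has `logb` equal to `0`,
  -- which is at most `N`.
  rcases (div_nonneg hv (div_nonneg hm' hm)).eq_or_lt with h0 | hpos
  · rw [← h0]
    simp
  · rw [Real.logb_le_iff_le_rpow (by norm_num) hpos, Real.rpow_natCast]
    have hne : m' ≠ 0 := by rintro rfl; simp at hpos
    have hne' : m ≠ 0 := by rintro rfl; simp at hpos
    rw [one_div_pow, one_div_mul_eq_div, div_le_iff₀ (by positivity)] at h
    rw [div_div_eq_mul_div, div_le_iff₀ (lt_of_le_of_ne hm' hne.symm)]
    linarith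

end AlgoPrediction

theorem theorem1 {X : Type*} [Fintype X] [Primcodable X]
    (U : List Bool × List X →. ℕ) (hU : IsUniversal U)
    (V : (List X → ℝ) → List X → List X → ℝ) (hV : IsConditionalVersion V) :
    ∃ c : ℝ, ∀ μ : List X → ℝ, IsComputableMeasure μ → ∀ x y : List X,
      Real.logb 2 (V μ x y / (mixture U (x ++ y) / mixture U x)) ≤
        (condKFun U μ x : ℝ) + (plainK U x.length : ℝ) + c := by
  obtain ⟨W, hW, hWV⟩ := exists_enumeration_conditional (X := X)
  obtain ⟨R, hR, hRV⟩ := hV.effective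
  have hassoc : Computable fun t : (ℕ × List X) × List X × ℕ × ℕ => (t.1.1, t.1.2, t.2) :=
    ((Primrec.fst.comp Primrec.fst).pair
      ((Primrec.snd.comp Primrec.fst).pair Primrec.snd)).to_comp
  -- The strings of positive and of zero probability get separate enumerations and constants, so no
  -- program has to tell the two cases apart.
  obtain ⟨c₁, h₁⟩ := hU.exists_of_enumeration hW
  obtain ⟨c₂, h₂⟩ := hU.exists_of_enumeration (REPred.comp hR hassoc)
  refine ⟨(max c₁ c₂ : ℕ), fun μ hμ x y => ?_⟩
  -- The index is chosen after `x`, as the one that is cheapest given `x`; the constants do not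
  -- depend on it.
  obtain ⟨i, hi, hK⟩ := exists_isIndex_condK_eq (U := U) hμ.enumerable x
  have hVm := hV.isMeasure μ hμ x
  have hbound : ∃ c ≤ max c₁ c₂, ((1 : ℝ) / 2) ^ (condK U i x + plainK U x.length + c) *
      (mixture U x * V μ x y) ≤ mixture U (x ++ y) := by
    by_cases hx : μ x = 0
    · exact ⟨c₂, le_max_right _ _, h₂ i x _ hVm.isSemimeasure (hRV μ hμ i hi x hx) y⟩
    · refine ⟨c₁, le_max_left _ _, h₁ i x _ hVm.isSemimeasure (fun y k n => ?_) y⟩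
      rw [hV.eq_div μ hμ x hx y]
      exact hWV i μ hμ.isMeasure hi x hx y k n
  obtain ⟨c, hc, h⟩ := hbound
  have hlog := logb_div_div_le (hVm.nonneg y) (mixture_nonneg U x) (mixture_nonneg U (x ++ y)) h
  rw [hK] at hlog
  have hc' : (c : ℝ) ≤ (max c₁ c₂ : ℕ) := by exact_mod_cast hc
  push_cast at hlog hc' ⊢
  linarith
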